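/- **Setting.** Let $N$ be a smooth $n$-manifold and $F:TN\to[0,\infty)$ a Finsler function: $F$ is smooth on $TN^0=TN\setminus 0(N)$, vanishes exactly on the zero section, satisfies $F(x,ty)=tF(x,y)$ for $t>0$, and, in the coordinates $(x^a,y^a)$ induced on $TN$ by charts of $N$, the matrix $g_{ab}=\frac12\frac{\partial^2F^2}{\partial y^a\partial y^b}$ is positive definite on $TN^0$. Put $$G^a=\tfrac14 g^{ab}\Big(\frac{\partial^2F^2}{\partial y^b\partial x^c}y^c-\frac{\partial F^2}{\partial x^b}\Big),\quad G^a_b=\frac{\partial G^a}{\partial y^b},\quad \frac{\delta}{\delta x^a}=\frac{\partial}{\partial x^a}-G^b_a\frac{\partial}{\partial y^b},\quad \delta y^a=dy^a+G^a_b\,dx^b .$$ Let $V(N)$ be spanned by the $\frac{\partial}{\partial y^a}$ and $H(N)$ by the $\frac{\delta}{\delta x^a}$, with projectors $Q$ onto $V(N)$ and $Q^\perp$ onto $H(N)$. Let $G=g_{ab}\,dx^a\otimes dx^b+g_{ab}\,\delta y^a\otimes\delta y^b$ be the Sasaki–Finsler metric and $W(G)=\theta_F=\frac12\frac{\partial F^2}{\partial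 y^a}dx^a$ the Cartan form; these are globally defined on $TN^0$. Let $\tilde\nabla$ be the Weyl connection, i.e. the torsion-free linear connection on $TN^0$ with $\tilde\nabla G+\theta_F\otimes G=0$, given by $$\begin{aligned}2G(\tilde\nabla_XY,Z)={}&X\,G(Y,Z)+Y\,G(Z,X)-Z\,G(X,Y)+G([X,Y],Z)-G([Y,Z],X)+G([Z,X],Y)\\&+\theta_F(X)G(Y,Z)+\theta_F(Y)G(Z,X)-\theta_F(Z)G(X,Y).\end{aligned}$$ The Vranceanu connection of $(TN,F,\theta_F)$ is $$\nabla^*_XY=Q\tilde\nabla_{QX}QY+Q^\perp\tilde\nabla_{Q^\perp X}Q^\perp Y+Q[Q^\perp X,QY]+Q^\perp[QX,Q^\perp Y].$$ **Proposition 3.5.** For every chart of $N$ in its smooth structure, the fields $\frac{\delta}{\delta x^a},\frac{\partial}{\partial y^a}$ form a frame at each point of $TN^0$ over the chart domain, and there $$\nabla^*_{\frac{\partial}{\partial y^b}}\frac{\partial}{\partial y^a}=C^c_{ab}\frac{\partial}{\partial y^c},\quad \nabla^*_{\frac{\delta}{\delta x^b}}\frac{\partial}{\partial y^a}=D^c_{ab}\frac{\partial}{\partial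 y^c},\quad \nabla^*_{\frac{\partial}{\partial y^b}}\frac{\delta}{\delta x^a}=L^c_{ab}\frac{\delta}{\delta x^c},\quad \nabla^*_{\frac{\delta}{\delta x^b}}\frac{\delta}{\delta x^a}=F^c_{ab}\frac{\delta}{\delta x^c}$$ with $$C^c_{ab}=\tfrac12 g^{cd}\frac{\partial g_{ab}}{\partial y^d},\qquad D^c_{ab}=\frac{\partial^2G^c}{\partial y^a\partial y^b},\qquad L^c_{ab}=0,$$ $$4F^c_{ab}=2g^{cd}\Big(\frac{\delta g_{db}}{\delta x^a}+\frac{\delta g_{ad}}{\delta x^b}-\frac{\delta g_{ab}}{\delta x^d}\Big)+\frac{\partial F^2}{\partial y^a}\delta^c_b+\frac{\partial F^2}{\partial y^b}\delta^c_a-\frac{\partial F^2}{\partial y^u}g^{uc}g_{ab}.$$ Moreover, at each such point, $$F^c_{ab}=\tfrac12 g^{cd}\Big(\frac{\delta g_{db}}{\delta x^a}+\frac{\delta g_{ad}}{\delta x^b}-\frac{\delta g_{ab}}{\delta x^d}\Big)+\tfrac12y^u\big(g_{ub}\delta^c_a+g_{au}\delta^c_b-g_{ab}\delta^c_u\big).$$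 -/

import Mathlib

open scoped Manifold ContDiff

namespace WeylVranceanu

/-! ### Weyl and Vranceanu connections on a manifold -/

section General

variable {E : Type*} [NormedAddCommGroup E] [NormedSpace ℝ E]
  {H : Type*} [TopologicalSpace H] (I : ModelWithCorners ℝ E H)
  {M : Type*} [TopologicalSpace M] [ChartedSpace H M] [IsManifold I 1 M]

/-- The derivative `X(f)` of a function `f` along a vector field `X`. -/
noncomputable def dirDeriv (X : Π p : M, TangentSpace I p) (f : M → ℝ) (p : M) : ℝ :=
  mfderiv I 𝓘(ℝ, ℝ) f p (X p)

/-- The right-hand side of the generalized Koszul formula for the metric `G` and the `1`-form `W`: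
`X G(Y,Z) + Y G(Z,X) - Z G(X,Y) + G([X,Y],Z) - G([Y,Z],X) + G([Z,X],Y)
  + W(X) G(Y,Z) + W(Y) G(Z,X) - W(Z) G(X,Y)`. -/
noncomputable def koszul
    (G : Π p : M, LinearMap.BilinForm ℝ (TangentSpace I p))
    (W : Π p : M, Module.Dual ℝ (TangentSpace I p))
    (X Y Z : Π p : M, TangentSpace I p) (p : M) : ℝ :=
  dirDeriv I X (fun q => G q (Y q) (Z q)) p
    + dirDeriv I Y (fun q => G q (Z q) (X q)) p
    - dirDeriv I Z (fun q => G q (X q) (Y q)) p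
    + G p (VectorField.mlieBracket I X Y p) (Z p)
    - G p (VectorField.mlieBracket I Y Z p) (X p)
    + G p (VectorField.mlieBracket I Z X p) (Y p)
    + W p (X p) * G p (Y p) (Z p)
    + W p (Y p) * G p (Z p) (X p)
    - W p (Z p) * G p (X p) (Y p)

open Classical in
/-- The Weyl connection of `(M, G, W)`: `∇_X Y` at `p` is the tangent vector `w` such that
`2 G(w, Z) = koszul X Y Z` for every vector field `Z` that is differentiable at `p`
(and `0` if there is no such vector). -/
noncomputable def weylConnection
    (G : Π p : M, LinearMap.BilinForm ℝ (TangentSpace I p))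
    (W : Π p : M, Module.Dual ℝ (TangentSpace I p))
    (X Y : Π p : M, TangentSpace I p) (p : M) : TangentSpace I p :=
  if h : ∃ w : TangentSpace I p, ∀ Z : Π q : M, TangentSpace I q,
      MDifferentiableAt I I.tangent (fun q => (⟨q, Z q⟩ : TangentBundle I M)) p →
        2 * G p w (Z p) = koszul I G W X Y Z p
  then h.choose else 0

set_option linter.unusedSectionVars false in
/-- A torsion-free operation `D` (with `D X Y` for `∇_X Y`) with `∇ G + W ⊗ G = 0`, where `G` is
symmetric, satisfies the generalized Koszul formula. So `weylConnection` is the torsion-free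
linear connection compatible with `G` and `W`. -/
theorem koszul_of_torsionFree_of_compatible
    (G : Π p : M, LinearMap.BilinForm ℝ (TangentSpace I p))
    (W : Π p : M, Module.Dual ℝ (TangentSpace I p))
    (D : (Π p : M, TangentSpace I p) → (Π p : M, TangentSpace I p) → Π p : M, TangentSpace I p)
    (p : M) (X Y Z : Π p : M, TangentSpace I p)
    (hsymm : ∀ u v : TangentSpace I p, G p u v = G p v u)
    (htor : ∀ A ∈ ({X, Y, Z} : Set (Π p : M, TangentSpace I p)),
      ∀ B ∈ ({X, Y, Z} : Set (Π p : M, TangentSpace I p)),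
      D A B p - D B A p = VectorField.mlieBracket I A B p)
    (hcomp : ∀ A ∈ ({X, Y, Z} : Set (Π p : M, TangentSpace I p)),
      ∀ B ∈ ({X, Y, Z} : Set (Π p : M, TangentSpace I p)),
      ∀ C ∈ ({X, Y, Z} : Set (Π p : M, TangentSpace I p)),
      dirDeriv I A (fun q => G q (B q) (C q)) p - G p (D A B p) (C p) - G p (B p) (D A C p)
        + W p (A p) * G p (B p) (C p) = 0) :
    2 * G p (D X Y p) (Z p) = koszul I G W X Y Z p := by
  have c1 := hcomp X (by simp) Y (by simp) Z (by simp)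
  have c2 := hcomp Y (by simp) Z (by simp) X (by simp)
  have c3 := hcomp Z (by simp) X (by simp) Y (by simp)
  unfold koszul
  rw [← htor X (by simp) Y (by simp), ← htor Y (by simp) Z (by simp),
    ← htor Z (by simp) X (by simp)]
  simp only [map_sub, LinearMap.sub_apply]
  have s1 := hsymm (Y p) (D X Z p)
  have s2 := hsymm (Z p) (D Y X p)
  have s3 := hsymm (X p) (D Z Y p)
  linarith

/-- The Vranceanu connection of `(M, G, W)` for complementary distributions with projectors
`Q` and `Q'`:
`∇*_X Y = Q ∇_{QX} QY + Q' ∇_{Q'X} Q'Y + Q [Q'X, QY] + Q' [QX, Q'Y]`,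
where `∇` is the Weyl connection. -/
noncomputable def vranceanu
    (G : Π p : M, LinearMap.BilinForm ℝ (TangentSpace I p))
    (W : Π p : M, Module.Dual ℝ (TangentSpace I p))
    (Q Q' : Π p : M, TangentSpace I p →ₗ[ℝ] TangentSpace I p)
    (X Y : Π p : M, TangentSpace I p) (p : M) : TangentSpace I p :=
  Q p (weylConnection I G W (fun q => Q q (X q)) (fun q => Q q (Y q)) p)
    + Q' p (weylConnection I G W (fun q => Q' q (X q)) (fun q => Q' q (Y q)) p)
    + Q p (VectorField.mlieBracket I (fun q => Q' q (X q)) (fun q => Q q (Y q)) p)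
    + Q' p (VectorField.mlieBracket I (fun q => Q q (X q)) (fun q => Q' q (Y q)) p)

end General

/-! ### Functions of the coordinates `(x, y)` -/

section Coordinates

variable {n : ℕ}

/-- The space `ℝⁿ` of coordinates. -/
abbrev Rn (n : ℕ) := EuclideanSpace ℝ (Fin n)

/-- `∂f/∂x^a` at `z = (x, y)`. -/
noncomputable def pdx (a : Fin n) (f : Rn n × Rn n → ℝ) (z : Rn n × Rn n) : ℝ :=
  fderiv ℝ f z (EuclideanSpace.single a 1, 0)

/-- `∂f/∂y^a` at `z = (x, y)`. -/
noncomputable def pdy (a : Fin n) (f : Rn n × Rn n → ℝ) (z : Rn n × Rn n) : ℝ :=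
  fderiv ℝ f z (0, EuclideanSpace.single a 1)

/-- The matrix `g_{ab} = ½ ∂²L/∂y^a∂y^b`, where `L` stands for `F²` in coordinates. -/
noncomputable def gMat (L : Rn n × Rn n → ℝ) (z : Rn n × Rn n) : Matrix (Fin n) (Fin n) ℝ :=
  Matrix.of fun a b => (1 / 2) * pdy a (pdy b L) z

/-- `G^a = ¼ g^{ab} (∂²L/∂y^b∂x^c y^c - ∂L/∂x^b)`. -/
noncomputable def sprayCoeff (L : Rn n × Rn n → ℝ) (a : Fin n) (z : Rn n × Rn n) : ℝ :=
  (1 / 4) * ∑ b, (gMat L z)⁻¹ a b * ((∑ c, pdy b (pdx c L) z * z.2 c) - pdx b L z)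

/-- `G^a_b = ∂G^a/∂y^b`. -/
noncomputable def nonlinCoeff (L : Rn n × Rn n → ℝ) (a b : Fin n) (z : Rn n × Rn n) : ℝ :=
  pdy b (sprayCoeff L a) z

/-- `δf/δx^a = ∂f/∂x^a - G^b_a ∂f/∂y^b`. -/
noncomputable def deltax (L : Rn n × Rn n → ℝ) (a : Fin n) (f : Rn n × Rn n → ℝ)
    (z : Rn n × Rn n) : ℝ :=
  pdx a f z - ∑ b, nonlinCoeff L b a z * pdy b f z

/-- The horizontal Christoffel term
`½ g^{cd} (δg_{db}/δx^a + δg_{ad}/δx^b - δg_{ab}/δx^d)`. -/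
noncomputable def horChristoffel (L : Rn n × Rn n → ℝ) (c a b : Fin n) (z : Rn n × Rn n) : ℝ :=
  (1 / 2) * ∑ d, (gMat L z)⁻¹ c d *
    (deltax L a (fun w => gMat L w d b) z + deltax L b (fun w => gMat L w a d) z
      - deltax L d (fun w => gMat L w a b) z)

end Coordinates

/-! ### Finsler manifolds -/

section Finsler

variable {n : ℕ} {N : Type*} [TopologicalSpace N] [ChartedSpace (Rn n) N]
  [IsManifold (𝓡 n) ∞ N]

/-- The coordinates `(x, y)` on `TN` induced by a chart `φ` of `N`. -/
noncomputable def tcoord (φ : OpenPartialHomeomorph N (Rn n)) (p : TangentBundle (𝓡 n) N) :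
    Rn n × Rn n :=
  (φ p.1, mfderiv (𝓡 n) (𝓡 n) φ p.1 p.2)

/-- The function `F²` in the coordinates `(x, y)` induced by a chart `φ`. -/
noncomputable def sqLoc (F : TangentBundle (𝓡 n) N → ℝ) (φ : OpenPartialHomeomorph N (Rn n))
    (z : Rn n × Rn n) : ℝ :=
  F ⟨φ.symm z.1, mfderiv (𝓡 n) (𝓡 n) φ.symm z.1 z.2⟩ ^ 2

/-- `(N, F)` is a Finsler manifold. -/
structure IsFinsler (F : TangentBundle (𝓡 n) N → ℝ) : Prop where
  nonneg : ∀ p, 0 ≤ F p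
  smooth : ContMDiffOn (𝓡 n).tangent 𝓘(ℝ, ℝ) ∞ F {p | p.2 ≠ 0}
  eq_zero_iff : ∀ p, F p = 0 ↔ p.2 = 0
  homogeneous : ∀ (x : N) (v : TangentSpace (𝓡 n) x) (t : ℝ), 0 < t →
    F ⟨x, t • v⟩ = t * F ⟨x, v⟩
  posDef : ∀ φ ∈ IsManifold.maximalAtlas (𝓡 n) ∞ N, ∀ z : Rn n × Rn n,
    z.1 ∈ φ.target → z.2 ≠ 0 → (gMat (sqLoc F φ) z).PosDef

/-- The local vector field `∂/∂y^a` on `TN`. -/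
noncomputable def vertField (φ : OpenPartialHomeomorph N (Rn n)) (a : Fin n) :
    Π p : TangentBundle (𝓡 n) N, TangentSpace (𝓡 n).tangent p :=
  VectorField.mpullback (𝓡 n).tangent 𝓘(ℝ, Rn n × Rn n) (tcoord φ)
    (fun _ => ((0, EuclideanSpace.single a 1) : Rn n × Rn n))

/-- The local vector field `δ/δx^a = ∂/∂x^a - G^b_a ∂/∂y^b` on `TN`. -/
noncomputable def horField (F : TangentBundle (𝓡 n) N → ℝ) (φ : OpenPartialHomeomorph N (Rn n))
    (a : Fin n) : Π p : TangentBundle (𝓡 n) N, TangentSpace (𝓡 n).tangent p :=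
  VectorField.mpullback (𝓡 n).tangent 𝓘(ℝ, Rn n × Rn n) (tcoord φ)
    (fun z => ((EuclideanSpace.single a 1,
      -∑ b, nonlinCoeff (sqLoc F φ) b a z • EuclideanSpace.single b 1) : Rn n × Rn n))

/-- The coordinate `1`-form `dx^a` on `TN`. -/
noncomputable def dxForm (φ : OpenPartialHomeomorph N (Rn n)) (a : Fin n)
    (p : TangentBundle (𝓡 n) N) : Module.Dual ℝ (TangentSpace (𝓡 n).tangent p) :=
  (EuclideanSpace.proj a ∘L ContinuousLinearMap.fst ℝ (Rn n) (Rn n) ∘L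
    (mfderiv (𝓡 n).tangent 𝓘(ℝ, Rn n × Rn n) (tcoord φ) p)).toLinearMap

/-- The coordinate `1`-form `dy^a` on `TN`. -/
noncomputable def dyForm (φ : OpenPartialHomeomorph N (Rn n)) (a : Fin n)
    (p : TangentBundle (𝓡 n) N) : Module.Dual ℝ (TangentSpace (𝓡 n).tangent p) :=
  (EuclideanSpace.proj a ∘L ContinuousLinearMap.snd ℝ (Rn n) (Rn n) ∘L
    (mfderiv (𝓡 n).tangent 𝓘(ℝ, Rn n × Rn n) (tcoord φ) p)).toLinearMap

/-- The `1`-form `δy^a = dy^a + G^a_b dx^b` on `TN`. -/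
noncomputable def deltayForm (F : TangentBundle (𝓡 n) N → ℝ)
    (φ : OpenPartialHomeomorph N (Rn n)) (a : Fin n)
    (p : TangentBundle (𝓡 n) N) : Module.Dual ℝ (TangentSpace (𝓡 n).tangent p) :=
  dyForm φ a p + ∑ b, nonlinCoeff (sqLoc F φ) a b (tcoord φ p) • dxForm φ b p

/-! The next four objects are independent of the chart used to write them; at each point `p` they
are written in the preferred chart of `N` at the base point of `p`. -/

/-- The projector `Q = δy^a ⊗ ∂/∂y^a` onto the vertical distribution along the horizontal one. -/
noncomputable def vertProj (F : TangentBundle (𝓡 n) N → ℝ) (p : TangentBundle (𝓡 n) N) :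
    TangentSpace (𝓡 n).tangent p →ₗ[ℝ] TangentSpace (𝓡 n).tangent p :=
  ∑ a, (deltayForm F (chartAt (Rn n) p.1) a p).smulRight (vertField (chartAt (Rn n) p.1) a p)

/-- The projector `Q' = dx^a ⊗ δ/δx^a` onto the horizontal distribution along the vertical one. -/
noncomputable def horProj (F : TangentBundle (𝓡 n) N → ℝ) (p : TangentBundle (𝓡 n) N) :
    TangentSpace (𝓡 n).tangent p →ₗ[ℝ] TangentSpace (𝓡 n).tangent p :=
  ∑ a, (dxForm (chartAt (Rn n) p.1) a p).smulRight (horField F (chartAt (Rn n) p.1) a p)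

/-- The Sasaki-Finsler metric `G = g_{ab} dx^a ⊗ dx^b + g_{ab} δy^a ⊗ δy^b`. -/
noncomputable def sasaki (F : TangentBundle (𝓡 n) N → ℝ) (p : TangentBundle (𝓡 n) N) :
    LinearMap.BilinForm ℝ (TangentSpace (𝓡 n).tangent p) :=
  let φ := chartAt (Rn n) p.1
  ∑ a, ∑ b, gMat (sqLoc F φ) (tcoord φ p) a b •
    (LinearMap.BilinForm.linMulLin (dxForm φ a p) (dxForm φ b p)
      + LinearMap.BilinForm.linMulLin (deltayForm F φ a p) (deltayForm F φ b p))

/-- The Cartan form `θ_F = ½ ∂F²/∂y^a dx^a`. -/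
noncomputable def cartanForm (F : TangentBundle (𝓡 n) N → ℝ) (p : TangentBundle (𝓡 n) N) :
    Module.Dual ℝ (TangentSpace (𝓡 n).tangent p) :=
  let φ := chartAt (Rn n) p.1
  ∑ a, ((1 / 2) * pdy a (sqLoc F φ) (tcoord φ p)) • dxForm φ a p

/-- The Vranceanu connection of the Weyl manifold `(TN, F, θ_F)`: metric `G` the Sasaki-Finsler
metric, `1`-form `W(G) = θ_F`, decomposition `T(TN) = V(N) ⊕ H(N)`. -/
noncomputable def vranceanuCartan (F : TangentBundle (𝓡 n) N → ℝ)
    (X Y : Π p : TangentBundle (𝓡 n) N, TangentSpace (𝓡 n).tangent p)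
    (p : TangentBundle (𝓡 n) N) : TangentSpace (𝓡 n).tangent p :=
  vranceanu (𝓡 n).tangent (sasaki F) (cartanForm F) (vertProj F) (horProj F) X Y p

end Finsler

end WeylVranceanu

open WeylVranceanu

/-!
The Vranceanu connection is evaluated on the adapted frame `δ/δx^a, ∂/∂y^a` in the coordinates
`(x, y)` of an arbitrary chart `φ`.

The projectors, the metric and the Cartan form are defined pointwise through the preferred chart of
each base point, which jumps from point to point, so their chart independence has to be proved
before anything can be differentiated. The spray `(y, -2G)` is characterized by the Euler-Lagrange
equation `D²L ((0, w), (y, -2G)) = DL (w, 0)` for all `w` (`hess_spray`). The chain rule along vertical lines and nondegeneracy of the vertical Hessian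
give the transformation law `G' = Dτ G - ½ D²τ(y, y)` (`sprayVec_comp_tangentLift`), and
differentiating once in `y` gives `N' Dτ = Dτ N - D²τ(·, y)` (`nonlinMap_comp_tangentLift`),
that is, invariance of the horizontal distribution. Consequently `vertProj`, `horProj`, `sasaki` and
`cartanForm` have the expected expressions in every chart (`tderiv_vertProj`, `tderiv_horProj`,
`sasaki_apply`, `cartanForm_apply`).

The Weyl connection is characterized by the generalized Koszul formula. Its right-hand side is
tensorial in the last argument (`koszul_tensorialAt`), so by nondegeneracy of the metric a solution
exists (`weylConnection_koszul`), and testing it against the frame computes it. On vertical fields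
the Cartan form vanishes and total symmetry of `∂g_{ab}/∂y^c` collapses the three derivative terms
into one; on horizontal fields the brackets are vertical, hence orthogonal to the horizontal frame,
and only the horizontal Christoffel term and the Cartan form remain. The mixed components reduce to the
bracket `[δ/δx^b, ∂/∂y^a] = ∂G^c_b/∂y^a ∂/∂y^c`, which is vertical. The last identity is Euler's
relation `∂L/∂y^a = 2 g_{au} y^u` (`pdy_eq_of_homogeneous`).
-/

namespace WeylVranceanu

section CoordinateCalculus

/-! ### Derivatives of functions of `(x, y)` and the fundamental tensor -/

open Matrix

variable {n : ℕ}

theorem sum_smul_single (v : Rn n) : ∑ a, v a • EuclideanSpace.single a (1 : ℝ) = v := by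
  ext i
  simp [Pi.single_apply]

theorem clm_fst_eq_sum (T : Rn n × Rn n →L[ℝ] ℝ) (w : Rn n) :
    T (w, 0) = ∑ a, w a * T (EuclideanSpace.single a 1, 0) := by
  have h : (w, (0 : Rn n)) = ∑ a, w a • (EuclideanSpace.single a (1 : ℝ), (0 : Rn n)) := by
    ext1
    · simp [Prod.fst_sum, sum_smul_single]
    · simp [Prod.snd_sum]
  rw [h, map_sum]
  simp only [map_smul, smul_eq_mul]

theorem clm_snd_eq_sum (T : Rn n × Rn n →L[ℝ] ℝ) (w : Rn n) :
    T (0, w) = ∑ a, w a * T (0, EuclideanSpace.single a 1) := by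
  have h : ((0 : Rn n), w) = ∑ a, w a • ((0 : Rn n), EuclideanSpace.single a (1 : ℝ)) := by
    ext1
    · simp [Prod.fst_sum]
    · simp [Prod.snd_sum, sum_smul_single]
  rw [h, map_sum]
  simp only [map_smul, smul_eq_mul]

theorem contDiffAt_fderiv_apply {f : Rn n × Rn n → ℝ} {z : Rn n × Rn n}
    (hf : ContDiffAt ℝ ∞ f z) (u : Rn n × Rn n) :
    ContDiffAt ℝ ∞ (fun w => fderiv ℝ f w u) z :=
  (hf.fderiv_right (m := ∞) (by simp)).clm_apply contDiffAt_const

theorem contDiffAt_pdx {f : Rn n × Rn n → ℝ} {z : Rn n × Rn n}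
    (hf : ContDiffAt ℝ ∞ f z) (a : Fin n) : ContDiffAt ℝ ∞ (pdx a f) z :=
  contDiffAt_fderiv_apply hf _

theorem contDiffAt_pdy {f : Rn n × Rn n → ℝ} {z : Rn n × Rn n}
    (hf : ContDiffAt ℝ ∞ f z) (a : Fin n) : ContDiffAt ℝ ∞ (pdy a f) z :=
  contDiffAt_fderiv_apply hf _

theorem differentiableAt_fderiv {f : Rn n × Rn n → ℝ} {z : Rn n × Rn n}
    (hf : ContDiffAt ℝ ∞ f z) : DifferentiableAt ℝ (fderiv ℝ f) z :=
  (hf.fderiv_right (m := ∞) (by simp)).differentiableAt (by simp)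

theorem two_le_infty : (2 : ℕ∞ω) ≤ ∞ := by
  exact ENat.LEInfty.out

theorem fderiv_fderiv_apply {f : Rn n × Rn n → ℝ} {z : Rn n × Rn n}
    (hf : ContDiffAt ℝ ∞ f z) (u v : Rn n × Rn n) :
    fderiv ℝ (fun w => fderiv ℝ f w v) z u = fderiv ℝ (fderiv ℝ f) z u v := by
  rw [fderiv_clm_apply (differentiableAt_fderiv hf) (differentiableAt_const v)]
  simp

theorem fderiv_fderiv_comm {f : Rn n × Rn n → ℝ} {z : Rn n × Rn n}
    (hf : ContDiffAt ℝ ∞ f z) (u v : Rn n × Rn n) :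
    fderiv ℝ (fderiv ℝ f) z u v = fderiv ℝ (fderiv ℝ f) z v u :=
  hf.isSymmSndFDerivAt (by simpa using two_le_infty) u v

theorem pdy_pdy_comm {f : Rn n × Rn n → ℝ} {z : Rn n × Rn n}
    (hf : ContDiffAt ℝ ∞ f z) (a b : Fin n) : pdy a (pdy b f) z = pdy b (pdy a f) z := by
  unfold pdy
  rw [fderiv_fderiv_apply hf, fderiv_fderiv_apply hf, fderiv_fderiv_comm hf]

/-- The function `L`, which stands for `F²`, is smooth at `z` with positive definite vertical
Hessian. -/
structure IsRegularAt (L : Rn n × Rn n → ℝ) (z : Rn n × Rn n) : Prop where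
  smooth : ContDiffAt ℝ ∞ L z
  posDef : (gMat L z).PosDef

theorem gMat_apply_eq {L : Rn n × Rn n → ℝ} {z : Rn n × Rn n} (hL : ContDiffAt ℝ ∞ L z)
    (a b : Fin n) : gMat L z a b = (1 / 2) *
      fderiv ℝ (fderiv ℝ L) z (0, EuclideanSpace.single a 1) (0, EuclideanSpace.single b 1) := by
  rw [← fderiv_fderiv_apply hL]
  rfl

theorem gMat_symm {L : Rn n × Rn n → ℝ} {z : Rn n × Rn n} (hL : ContDiffAt ℝ ∞ L z)
    (a b : Fin n) : gMat L z a b = gMat L z b a := by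
  rw [gMat_apply_eq hL, gMat_apply_eq hL, fderiv_fderiv_comm hL]

theorem contDiffAt_gMat {L : Rn n × Rn n → ℝ} {z : Rn n × Rn n} (hL : ContDiffAt ℝ ∞ L z)
    (a b : Fin n) : ContDiffAt ℝ ∞ (fun w => gMat L w a b) z :=
  contDiffAt_const.mul (contDiffAt_pdy (contDiffAt_pdy hL b) a)

theorem fderiv_fderiv_vert {L : Rn n × Rn n → ℝ} {z : Rn n × Rn n} (hL : ContDiffAt ℝ ∞ L z)
    (u v : Rn n) : fderiv ℝ (fderiv ℝ L) z (0, u) (0, v) =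
      2 * ∑ a, ∑ b, gMat L z a b * (u a * v b) := by
  have h1 := clm_snd_eq_sum ((fderiv ℝ (fderiv ℝ L) z).flip (0, v)) u
  simp only [ContinuousLinearMap.flip_apply] at h1
  rw [h1, Finset.mul_sum]
  refine Finset.sum_congr rfl fun a _ => ?_
  rw [clm_snd_eq_sum (fderiv ℝ (fderiv ℝ L) z _) v, Finset.mul_sum, Finset.mul_sum]
  refine Finset.sum_congr rfl fun b _ => ?_
  rw [gMat_apply_eq hL]
  ring

/-- Nondegeneracy of the vertical Hessian. -/
theorem eq_zero_of_vertHess {L : Rn n × Rn n → ℝ} {z : Rn n × Rn n} (hL : IsRegularAt L z)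
    {v : Rn n} (h : ∀ w : Rn n, fderiv ℝ (fderiv ℝ L) z (0, w) (0, v) = 0) : v = 0 := by
  by_contra hv
  have hv' : (v : Fin n → ℝ) ≠ 0 := fun h0 => hv (by ext i; exact congrFun h0 i)
  have h1 := hL.posDef.dotProduct_mulVec_pos hv'
  have h2 := h v
  rw [fderiv_fderiv_vert hL.smooth] at h2
  have h3 : star (v : Fin n → ℝ) ⬝ᵥ gMat L z *ᵥ (v : Fin n → ℝ) =
      ∑ a, ∑ b, gMat L z a b * (v a * v b) := by
    simp only [dotProduct, mulVec, star_trivial, Finset.mul_sum]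
    exact Finset.sum_congr rfl fun a _ => Finset.sum_congr rfl fun b _ => by ring
  rw [h3] at h1
  linarith

theorem gMat_mul_inv {L : Rn n × Rn n → ℝ} {z : Rn n × Rn n} (hL : IsRegularAt L z) :
    gMat L z * (gMat L z)⁻¹ = 1 :=
  mul_nonsing_inv _ ((isUnit_iff_isUnit_det _).1 hL.posDef.isUnit)

theorem gMat_inv_mul {L : Rn n × Rn n → ℝ} {z : Rn n × Rn n} (hL : IsRegularAt L z) :
    (gMat L z)⁻¹ * gMat L z = 1 :=
  nonsing_inv_mul _ ((isUnit_iff_isUnit_det _).1 hL.posDef.isUnit)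

theorem contDiffAt_det {A : Rn n × Rn n → Matrix (Fin n) (Fin n) ℝ} {z : Rn n × Rn n}
    (hA : ∀ a b, ContDiffAt ℝ ∞ (fun w => A w a b) z) :
    ContDiffAt ℝ ∞ (fun w => (A w).det) z := by
  simp only [det_apply']
  exact ContDiffAt.sum fun σ _ => contDiffAt_const.mul (contDiffAt_prod fun i _ => hA _ _)

theorem contDiffAt_inv_apply {A : Rn n × Rn n → Matrix (Fin n) (Fin n) ℝ} {z : Rn n × Rn n}
    (hA : ∀ a b, ContDiffAt ℝ ∞ (fun w => A w a b) z) (hz : (A z).det ≠ 0) (a b : Fin n) :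
    ContDiffAt ℝ ∞ (fun w => (A w)⁻¹ a b) z := by
  simp only [inv_def, Matrix.smul_apply, smul_eq_mul, Ring.inverse_eq_inv', adjugate_apply]
  refine ((contDiffAt_det hA).inv hz).mul (contDiffAt_det fun i j => ?_)
  by_cases h : i = b
  · subst h
    simpa only [updateRow_self] using contDiffAt_const
  · simpa only [updateRow_ne h] using hA i j

theorem contDiffAt_gMat_inv {L : Rn n × Rn n → ℝ} {z : Rn n × Rn n} (hL : IsRegularAt L z)
    (a b : Fin n) : ContDiffAt ℝ ∞ (fun w => (gMat L w)⁻¹ a b) z :=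
  contDiffAt_inv_apply (contDiffAt_gMat hL.smooth) hL.posDef.det_pos.ne' a b

/-! ### The spray and the nonlinear connection in coordinates -/

theorem contDiffAt_sprayCoeff {L : Rn n × Rn n → ℝ} {z : Rn n × Rn n} (hL : IsRegularAt L z)
    (a : Fin n) : ContDiffAt ℝ ∞ (sprayCoeff L a) z := by
  refine contDiffAt_const.mul (ContDiffAt.sum fun b _ => (contDiffAt_gMat_inv hL a b).mul
    ((ContDiffAt.sum fun c _ => ?_).sub (contDiffAt_pdx hL.smooth b)))
  refine (contDiffAt_pdy (contDiffAt_pdx hL.smooth c) b).mul ?_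
  exact ((EuclideanSpace.proj (𝕜 := ℝ) c).contDiff.comp contDiff_snd).contDiffAt

theorem contDiffAt_nonlinCoeff {L : Rn n × Rn n → ℝ} {z : Rn n × Rn n} (hL : IsRegularAt L z)
    (a b : Fin n) : ContDiffAt ℝ ∞ (nonlinCoeff L a b) z :=
  contDiffAt_pdy (contDiffAt_sprayCoeff hL a) b

/-- The vector `(G^a)` of spray coefficients. -/
noncomputable def sprayVec (L : Rn n × Rn n → ℝ) (z : Rn n × Rn n) : Rn n :=
  WithLp.toLp 2 fun a => sprayCoeff L a z

/-- The nonlinear connection `(G^b_a)` as an endomorphism of the fibre: `w ↦ G^b_a w^a e_b`. -/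
noncomputable def nonlinMap (L : Rn n × Rn n → ℝ) (z : Rn n × Rn n) : Rn n →ₗ[ℝ] Rn n where
  toFun w := WithLp.toLp 2 fun b => ∑ a, nonlinCoeff L b a z * w a
  map_add' u v := by
    ext b
    simp [mul_add, Finset.sum_add_distrib]
  map_smul' c v := by
    ext b
    simp only [PiLp.smul_apply, smul_eq_mul, RingHom.id_apply, Finset.mul_sum]
    exact Finset.sum_congr rfl fun a _ => by ring

@[simp] theorem nonlinMap_apply (L : Rn n × Rn n → ℝ) (z : Rn n × Rn n) (w : Rn n) (b : Fin n) :
    nonlinMap L z w b = ∑ a, nonlinCoeff L b a z * w a := rfl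

theorem contDiffAt_sprayVec {L : Rn n × Rn n → ℝ} {z : Rn n × Rn n} (hL : IsRegularAt L z) :
    ContDiffAt ℝ ∞ (sprayVec L) z :=
  contDiffAt_euclidean.2 fun a => contDiffAt_sprayCoeff hL a

theorem fderiv_sprayVec_vert {L : Rn n × Rn n → ℝ} {z : Rn n × Rn n} (hL : IsRegularAt L z)
    (w : Rn n) : fderiv ℝ (sprayVec L) z (0, w) = nonlinMap L z w := by
  ext b
  have h1 : HasFDerivAt (sprayCoeff L b)
      ((EuclideanSpace.proj (𝕜 := ℝ) b).comp (fderiv ℝ (sprayVec L) z)) z :=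
    (EuclideanSpace.proj (𝕜 := ℝ) b).hasFDerivAt.comp z
      ((contDiffAt_sprayVec hL).differentiableAt (by simp)).hasFDerivAt
  have h2 : fderiv ℝ (sprayVec L) z (0, w) b = fderiv ℝ (sprayCoeff L b) z (0, w) := by
    rw [h1.fderiv]; rfl
  rw [h2, clm_snd_eq_sum, nonlinMap_apply]
  exact Finset.sum_congr rfl fun a _ => mul_comm _ _

/-- The spray `(y, -2G)` is the Euler-Lagrange vector field of `L`: it is determined by
`D²L ((0, w), (y, -2G)) = DL (w, 0)` for all `w`. -/
theorem hess_spray {L : Rn n × Rn n → ℝ} {z : Rn n × Rn n} (hL : IsRegularAt L z) (w : Rn n) :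
    fderiv ℝ (fderiv ℝ L) z (0, w) (z.2, -((2 : ℝ) • sprayVec L z)) = fderiv ℝ L z (w, 0) := by
  have hsplit : (z.2, -((2 : ℝ) • sprayVec L z)) =
      ((z.2, 0) : Rn n × Rn n) - (2 : ℝ) • ((0 : Rn n), sprayVec L z) := by
    ext1 <;> simp
  have hlow : ∀ b, ∑ a, gMat L z b a * sprayCoeff L a z =
      (1 / 4) * ((∑ c, pdy b (pdx c L) z * z.2 c) - pdx b L z) := by
    intro b
    have h := congrFun (congrArg (fun A => A *ᵥ
      (fun b => (∑ c, pdy b (pdx c L) z * z.2 c) - pdx b L z)) (gMat_mul_inv hL)) b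
    simp only [← mulVec_mulVec, one_mulVec] at h
    rw [← h]
    simp only [mulVec, dotProduct, sprayCoeff, Finset.mul_sum]
    refine Finset.sum_congr rfl fun a _ => Finset.sum_congr rfl fun c _ => ?_
    ring
  rw [hsplit, map_sub, map_smul, fderiv_fderiv_vert hL.smooth, clm_fst_eq_sum (fderiv ℝ L z)]
  have h1 := clm_snd_eq_sum ((fderiv ℝ (fderiv ℝ L) z).flip (z.2, 0)) w
  simp only [ContinuousLinearMap.flip_apply] at h1
  have h2 : ∀ b, fderiv ℝ (fderiv ℝ L) z (0, EuclideanSpace.single b 1) (z.2, 0) =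
      ∑ c, pdy b (pdx c L) z * z.2 c := by
    intro b
    rw [clm_fst_eq_sum]
    refine Finset.sum_congr rfl fun c _ => ?_
    rw [← fderiv_fderiv_apply hL.smooth, mul_comm]
    rfl
  have h3 : ∑ b, ∑ a, gMat L z b a * (w b * sprayVec L z a) = ∑ b, w b *
      ((1 / 4) * ((∑ c, pdy b (pdx c L) z * z.2 c) - pdx b L z)) := by
    refine Finset.sum_congr rfl fun b _ => ?_
    rw [← hlow b, Finset.mul_sum]
    refine Finset.sum_congr rfl fun a _ => ?_
    change _ * (_ * sprayCoeff L a z) = _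
    ring
  rw [h1, h3, smul_eq_mul, Finset.mul_sum, Finset.mul_sum, ← Finset.sum_sub_distrib]
  refine Finset.sum_congr rfl fun b _ => ?_
  rw [h2]
  change _ = w b * pdx b L z
  ring

/-! ### Change of coordinates -/

/-- The map `(x, y) ↦ (τ x, Dτ(x) y)` of `TRⁿ` induced by a map `τ` of `Rⁿ`. -/
noncomputable def tangentLift (τ : Rn n → Rn n) (z : Rn n × Rn n) : Rn n × Rn n :=
  (τ z.1, fderiv ℝ τ z.1 z.2)

theorem hasFDerivAt_tangentLift {τ : Rn n → Rn n} {z : Rn n × Rn n}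
    (hτ : ContDiffAt ℝ ∞ τ z.1) : HasFDerivAt (tangentLift τ)
      (((fderiv ℝ τ z.1).comp (ContinuousLinearMap.fst ℝ (Rn n) (Rn n))).prod
        ((fderiv ℝ τ z.1).comp (ContinuousLinearMap.snd ℝ (Rn n) (Rn n)) +
          ((fderiv ℝ (fderiv ℝ τ) z.1).comp (ContinuousLinearMap.fst ℝ (Rn n) (Rn n))).flip z.2))
      z := by
  have h1 : HasFDerivAt (fun w : Rn n × Rn n => τ w.1) _ z :=
    (hτ.differentiableAt (by simp)).hasFDerivAt.comp z hasFDerivAt_fst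
  have h2 : HasFDerivAt (fun w : Rn n × Rn n => fderiv ℝ τ w.1) _ z :=
    (((hτ.fderiv_right (m := ∞) (by simp)).differentiableAt (by simp)).hasFDerivAt).comp z
      hasFDerivAt_fst
  exact h1.prodMk (h2.clm_apply hasFDerivAt_snd)

theorem fderiv_tangentLift {τ : Rn n → Rn n} {z : Rn n × Rn n}
    (hτ : ContDiffAt ℝ ∞ τ z.1) (u : Rn n × Rn n) : fderiv ℝ (tangentLift τ) z u =
      (fderiv ℝ τ z.1 u.1, fderiv ℝ τ z.1 u.2 + fderiv ℝ (fderiv ℝ τ) z.1 u.1 z.2) := by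
  rw [(hasFDerivAt_tangentLift hτ).fderiv]
  rfl

theorem hasDerivAt_vertLine (z : Rn n × Rn n) (w : Rn n) :
    HasDerivAt (fun t : ℝ => z + t • ((0 : Rn n), w)) (0, w) 0 := by
  simpa using ((hasDerivAt_id (0 : ℝ)).smul_const ((0 : Rn n), w)).const_add z

/-- Chain rule for `L = L' ∘ tangentLift τ`. -/
theorem fderiv_comp_tangentLift {τ : Rn n → Rn n} {L L' : Rn n × Rn n → ℝ} {z : Rn n × Rn n}
    (hτ : ContDiffAt ℝ ∞ τ z.1) (hL' : DifferentiableAt ℝ L' (tangentLift τ z))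
    (h : L =ᶠ[nhds z] L' ∘ tangentLift τ) (u : Rn n × Rn n) :
    fderiv ℝ L z u = fderiv ℝ L' (tangentLift τ z)
      (fderiv ℝ τ z.1 u.1, fderiv ℝ τ z.1 u.2 + fderiv ℝ (fderiv ℝ τ) z.1 u.1 z.2) := by
  rw [h.fderiv_eq, fderiv_comp z hL' (hasFDerivAt_tangentLift hτ).differentiableAt,
    ContinuousLinearMap.comp_apply, fderiv_tangentLift hτ]

/-- Second-order chain rule for `L = L' ∘ tangentLift τ`, one of the directions being vertical. -/
theorem fderiv_fderiv_comp_tangentLift {τ : Rn n → Rn n} {L L' : Rn n × Rn n → ℝ}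
    {z : Rn n × Rn n} (hτ : ContDiffAt ℝ ∞ τ z.1) (hL : ContDiffAt ℝ ∞ L z)
    (hL' : ContDiffAt ℝ ∞ L' (tangentLift τ z))
    (h : L =ᶠ[nhds z] L' ∘ tangentLift τ) (w : Rn n) (u : Rn n × Rn n) :
    fderiv ℝ (fderiv ℝ L) z (0, w) u =
      fderiv ℝ (fderiv ℝ L') (tangentLift τ z) (0, fderiv ℝ τ z.1 w)
        (fderiv ℝ τ z.1 u.1, fderiv ℝ τ z.1 u.2 + fderiv ℝ (fderiv ℝ τ) z.1 u.1 z.2)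
      + fderiv ℝ L' (tangentLift τ z) (0, fderiv ℝ (fderiv ℝ τ) z.1 u.1 w) := by
  -- Both sides are derivatives at `0` of `DL (z + t (0, w)) u`.
  have hline := hasDerivAt_vertLine z w
  have h0 : z + (0 : ℝ) • ((0 : Rn n), w) = z := by simp
  have hA : HasDerivAt (fun t : ℝ => fderiv ℝ L (z + t • ((0 : Rn n), w)) u)
      (fderiv ℝ (fderiv ℝ L) z (0, w) u) 0 := by
    have h1 : HasFDerivAt (fun v => fderiv ℝ L v u) (fderiv ℝ (fun v => fderiv ℝ L v u) z)
        (z + (0 : ℝ) • ((0 : Rn n), w)) := by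
      rw [h0]; exact ((contDiffAt_fderiv_apply hL u).differentiableAt (by simp)).hasFDerivAt
    rw [← fderiv_fderiv_apply hL]
    exact h1.comp_hasDerivAt (0 : ℝ) hline
  have hΘ : ∀ t : ℝ, tangentLift τ (z + t • ((0 : Rn n), w)) =
      tangentLift τ z + t • ((0 : Rn n), fderiv ℝ τ z.1 w) := by
    intro t
    simp [tangentLift]
  have hB : HasDerivAt (fun t : ℝ =>
      fderiv ℝ L' (tangentLift τ z + t • ((0 : Rn n), fderiv ℝ τ z.1 w))
        (fderiv ℝ τ z.1 u.1, fderiv ℝ τ z.1 u.2 + fderiv ℝ (fderiv ℝ τ) z.1 u.1 (z.2 + t • w)))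
      (fderiv ℝ (fderiv ℝ L') (tangentLift τ z) (0, fderiv ℝ τ z.1 w)
        (fderiv ℝ τ z.1 u.1, fderiv ℝ τ z.1 u.2 + fderiv ℝ (fderiv ℝ τ) z.1 u.1 z.2)
      + fderiv ℝ L' (tangentLift τ z) (0, fderiv ℝ (fderiv ℝ τ) z.1 u.1 w)) 0 := by
    have h1 : HasFDerivAt (fderiv ℝ L') (fderiv ℝ (fderiv ℝ L') (tangentLift τ z))
        (tangentLift τ z + (0 : ℝ) • ((0 : Rn n), fderiv ℝ τ z.1 w)) := by
      simpa using (differentiableAt_fderiv hL').hasFDerivAt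
    have h2 : HasDerivAt
        (fun t : ℝ => fderiv ℝ L' (tangentLift τ z + t • ((0 : Rn n), fderiv ℝ τ z.1 w)))
        (fderiv ℝ (fderiv ℝ L') (tangentLift τ z) (0, fderiv ℝ τ z.1 w)) 0 :=
      h1.comp_hasDerivAt (0 : ℝ) (hasDerivAt_vertLine (tangentLift τ z) (fderiv ℝ τ z.1 w))
    have h3 : HasDerivAt (fun t : ℝ => (fderiv ℝ τ z.1 u.1,
        fderiv ℝ τ z.1 u.2 + fderiv ℝ (fderiv ℝ τ) z.1 u.1 (z.2 + t • w)))
        ((0 : Rn n), fderiv ℝ (fderiv ℝ τ) z.1 u.1 w) 0 := by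
      refine (hasDerivAt_const (0 : ℝ) _).prodMk ?_
      have h4 : HasDerivAt (fun t : ℝ => z.2 + t • w) w 0 := by
        simpa using ((hasDerivAt_id (0 : ℝ)).smul_const w).const_add z.2
      exact ((fderiv ℝ (fderiv ℝ τ) z.1 u.1).hasFDerivAt.comp_hasDerivAt (0 : ℝ) h4).const_add _
    have h4 := h2.clm_apply h3
    simp only [zero_smul, add_zero] at h4
    exact h4
  have hτ' : ∀ᶠ x in nhds z.1, ContDiffAt ℝ 1 τ x :=
    (hτ.of_le (by simp)).eventually (by simp)
  have hL1 : ∀ᶠ v in nhds (tangentLift τ z), ContDiffAt ℝ 1 L' v :=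
    (hL'.of_le (by simp)).eventually (by simp)
  have hev : (fun t : ℝ => fderiv ℝ L (z + t • ((0 : Rn n), w)) u) =ᶠ[nhds 0] (fun t : ℝ =>
      fderiv ℝ L' (tangentLift τ z + t • ((0 : Rn n), fderiv ℝ τ z.1 w))
        (fderiv ℝ τ z.1 u.1, fderiv ℝ τ z.1 u.2 +
          fderiv ℝ (fderiv ℝ τ) z.1 u.1 (z.2 + t • w))) := by
    have hc : Filter.Tendsto (fun t : ℝ => z + t • ((0 : Rn n), w)) (nhds 0) (nhds z) := by
      simpa using hline.continuousAt.tendsto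
    have hc' : Filter.Tendsto (fun t : ℝ => tangentLift τ z + t • ((0 : Rn n), fderiv ℝ τ z.1 w))
        (nhds 0) (nhds (tangentLift τ z)) := by
      simpa using (hasDerivAt_vertLine (tangentLift τ z) (fderiv ℝ τ z.1 w)).continuousAt.tendsto
    filter_upwards [hc.eventually h.eventuallyEq_nhds, hc'.eventually hL1] with t ht ht'
    have hx : (z + t • ((0 : Rn n), w)).1 = z.1 := by simp
    have hy : (z + t • ((0 : Rn n), w)).2 = z.2 + t • w := by simp
    rw [fderiv_comp_tangentLift (by rw [hx]; exact hτ)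
      (by rw [hΘ]; exact ht'.differentiableAt (by simp)) ht u, hΘ, hx, hy]
  exact hA.unique (hB.congr_of_eventuallyEq hev)

/-- The tensors `g` and `g'` correspond to each other under a change of coordinates. -/
theorem sum_gMat_comp_tangentLift {τ : Rn n → Rn n} {L L' : Rn n × Rn n → ℝ}
    {z : Rn n × Rn n} (hτ : ContDiffAt ℝ ∞ τ z.1) (hL : ContDiffAt ℝ ∞ L z)
    (hL' : ContDiffAt ℝ ∞ L' (tangentLift τ z))
    (h : L =ᶠ[nhds z] L' ∘ tangentLift τ) (u v : Rn n) :
    ∑ a, ∑ b, gMat L' (tangentLift τ z) a b * (fderiv ℝ τ z.1 u a * fderiv ℝ τ z.1 v b) =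
      ∑ a, ∑ b, gMat L z a b * (u a * v b) := by
  have h1 := fderiv_fderiv_comp_tangentLift hτ hL hL' h u (0, v)
  simp only [map_zero, add_zero, _root_.zero_apply] at h1
  rw [← Prod.zero_eq_mk, map_zero, add_zero, fderiv_fderiv_vert hL, fderiv_fderiv_vert hL'] at h1
  linarith

/-- The spray coefficients transform by `G' = Dτ G - ½ D²τ(y, y)`. -/
theorem sprayVec_comp_tangentLift {τ : Rn n → Rn n} {L L' : Rn n × Rn n → ℝ}
    {z : Rn n × Rn n} (hτ : ContDiffAt ℝ ∞ τ z.1) (hsurj : Function.Surjective (fderiv ℝ τ z.1))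
    (hL : IsRegularAt L z) (hL' : IsRegularAt L' (tangentLift τ z))
    (h : L =ᶠ[nhds z] L' ∘ tangentLift τ) :
    sprayVec L' (tangentLift τ z) = fderiv ℝ τ z.1 (sprayVec L z)
      - (1 / 2 : ℝ) • fderiv ℝ (fderiv ℝ τ) z.1 z.2 z.2 := by
  have hsymm : ∀ u v, fderiv ℝ (fderiv ℝ τ) z.1 u v = fderiv ℝ (fderiv ℝ τ) z.1 v u :=
    fun u v => hτ.isSymmSndFDerivAt (by simpa using two_le_infty) u v
  -- The difference of the two sides is annihilated by the vertical Hessian of `L'`: transport the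
  -- Euler-Lagrange equation of `L` to `L'` and subtract that of `L'`.
  have key : sprayVec L' (tangentLift τ z) - (fderiv ℝ τ z.1 (sprayVec L z)
      - (1 / 2 : ℝ) • fderiv ℝ (fderiv ℝ τ) z.1 z.2 z.2) = 0 := by
    refine eq_zero_of_vertHess hL' fun w' => ?_
    obtain ⟨w, rfl⟩ := hsurj w'
    have h1 := hess_spray hL w
    rw [fderiv_fderiv_comp_tangentLift hτ hL.smooth hL'.smooth h,
      fderiv_comp_tangentLift hτ (hL'.smooth.differentiableAt (by simp)) h] at h1
    have h2 := hess_spray hL' (fderiv ℝ τ z.1 w)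
    have e1 : ((fderiv ℝ τ z.1 w, fderiv ℝ τ z.1 0 + fderiv ℝ (fderiv ℝ τ) z.1 w z.2) :
        Rn n × Rn n) = (fderiv ℝ τ z.1 w, 0) + (0, fderiv ℝ (fderiv ℝ τ) z.1 z.2 w) := by
      rw [hsymm w]; simp
    rw [e1, map_add, ← h2, add_left_inj, ← sub_eq_zero, ← map_sub] at h1
    have e2 : ((0 : Rn n), sprayVec L' (tangentLift τ z) - (fderiv ℝ τ z.1 (sprayVec L z)
      - (1 / 2 : ℝ) • fderiv ℝ (fderiv ℝ τ) z.1 z.2 z.2)) = (1 / 2 : ℝ) •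
        (((fderiv ℝ τ z.1 z.2, fderiv ℝ τ z.1 (-((2 : ℝ) • sprayVec L z)) +
          fderiv ℝ (fderiv ℝ τ) z.1 z.2 z.2) : Rn n × Rn n) -
        ((tangentLift τ z).2, -((2 : ℝ) • sprayVec L' (tangentLift τ z)))) := by
      ext1
      · simp [tangentLift]
      · simp only [Prod.smul_snd, Prod.snd_sub, map_neg, map_smul]
        module
    rw [e2, map_smul, h1, smul_zero]
  exact sub_eq_zero.1 key

/-- The nonlinear connection transforms by `N' Dτ = Dτ N - D²τ(·, y)`, so that the horizontal
distribution `η = -N ξ` does not depend on the coordinates. -/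
theorem nonlinMap_comp_tangentLift {τ : Rn n → Rn n} {L L' : Rn n × Rn n → ℝ}
    {z : Rn n × Rn n} (hτ : ContDiffAt ℝ ∞ τ z.1) (hsurj : Function.Surjective (fderiv ℝ τ z.1))
    (hL : ∀ᶠ v in nhds z, IsRegularAt L v)
    (hL' : ∀ᶠ v in nhds z, IsRegularAt L' (tangentLift τ v))
    (h : L =ᶠ[nhds z] L' ∘ tangentLift τ) (w : Rn n) :
    nonlinMap L' (tangentLift τ z) (fderiv ℝ τ z.1 w) = fderiv ℝ τ z.1 (nonlinMap L z w)
      - fderiv ℝ (fderiv ℝ τ) z.1 w z.2 := by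
  have hsymm : ∀ u v, fderiv ℝ (fderiv ℝ τ) z.1 u v = fderiv ℝ (fderiv ℝ τ) z.1 v u :=
    fun u v => hτ.isSymmSndFDerivAt (by simpa using two_le_infty) u v
  have hc : Filter.Tendsto (fun t : ℝ => z + t • ((0 : Rn n), w)) (nhds 0) (nhds z) := by
    simpa using (hasDerivAt_vertLine z w).continuousAt.tendsto
  have hΘ : ∀ t : ℝ, tangentLift τ (z + t • ((0 : Rn n), w)) =
      tangentLift τ z + t • ((0 : Rn n), fderiv ℝ τ z.1 w) := by
    intro t
    simp [tangentLift]
  -- Both sides are derivatives at `t = 0` of the transformation law of the spray coefficients along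
  -- the vertical line `z + t (0, w)`.
  have hA : HasDerivAt (fun t : ℝ =>
      sprayVec L' (tangentLift τ z + t • ((0 : Rn n), fderiv ℝ τ z.1 w)))
      (nonlinMap L' (tangentLift τ z) (fderiv ℝ τ z.1 w)) 0 := by
    have h1 : HasFDerivAt (sprayVec L') (fderiv ℝ (sprayVec L') (tangentLift τ z))
        (tangentLift τ z + (0 : ℝ) • ((0 : Rn n), fderiv ℝ τ z.1 w)) := by
      simpa using ((contDiffAt_sprayVec hL'.self_of_nhds).differentiableAt (by simp)).hasFDerivAt
    rw [← fderiv_sprayVec_vert hL'.self_of_nhds]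
    exact h1.comp_hasDerivAt (0 : ℝ) (hasDerivAt_vertLine _ _)
  have hB : HasDerivAt (fun t : ℝ => fderiv ℝ τ z.1 (sprayVec L (z + t • ((0 : Rn n), w)))
      - (1 / 2 : ℝ) • fderiv ℝ (fderiv ℝ τ) z.1 (z.2 + t • w) (z.2 + t • w))
      (fderiv ℝ τ z.1 (nonlinMap L z w) - fderiv ℝ (fderiv ℝ τ) z.1 w z.2) 0 := by
    have h1 : HasFDerivAt (sprayVec L) (fderiv ℝ (sprayVec L) z)
        (z + (0 : ℝ) • ((0 : Rn n), w)) := by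
      simpa using ((contDiffAt_sprayVec hL.self_of_nhds).differentiableAt (by simp)).hasFDerivAt
    have h2 := h1.comp_hasDerivAt (0 : ℝ) (hasDerivAt_vertLine z w)
    rw [fderiv_sprayVec_vert hL.self_of_nhds] at h2
    have h3 := (fderiv ℝ τ z.1).hasFDerivAt.comp_hasDerivAt (0 : ℝ) h2
    have h4 : HasDerivAt (fun t : ℝ => z.2 + t • w) w 0 := by
      simpa using ((hasDerivAt_id (0 : ℝ)).smul_const w).const_add z.2
    have h5 := ((fderiv ℝ (fderiv ℝ τ) z.1).hasFDerivAt.comp_hasDerivAt (0 : ℝ) h4).clm_apply h4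
    have h6 := h3.sub (h5.const_smul (1 / 2 : ℝ))
    refine h6.congr_deriv ?_
    simp only [Function.comp, zero_smul, add_zero, hsymm z.2 w]
    module
  refine hA.unique (hB.congr_of_eventuallyEq ?_)
  filter_upwards [hc.eventually hL, hc.eventually hL', hc.eventually h.eventuallyEq_nhds]
    with t ht ht' ht''
  have hx : (z + t • ((0 : Rn n), w)).1 = z.1 := by simp
  have hy : (z + t • ((0 : Rn n), w)).2 = z.2 + t • w := by simp
  have := sprayVec_comp_tangentLift (by rw [hx]; exact hτ) (by rw [hx]; exact hsurj) ht ht' ht''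
  rwa [hΘ, hx, hy] at this

/-! ### Homogeneity -/

/-- Euler's relations for a function `L` that is positively homogeneous of degree two in `y`. -/
theorem pdy_eq_of_homogeneous {L : Rn n × Rn n → ℝ} {z : Rn n × Rn n}
    (hL : ContDiffAt ℝ ∞ L z)
    (hom : ∀ (x y : Rn n) (t : ℝ), 0 < t → L (x, t • y) = t ^ 2 * L (x, y)) (a : Fin n) :
    pdy a L z = 2 * ∑ u, gMat L z a u * z.2 u := by
  have h1 : ∀ᶠ w in nhds z, ContDiffAt ℝ 1 L w := (hL.of_le (by simp)).eventually (by simp)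
  -- Euler's relation of first order, near `z`; differentiating it in the direction `∂/∂y^a` gives
  -- the claim.
  have h2 : (fun w : Rn n × Rn n => fderiv ℝ L w (0, w.2)) =ᶠ[nhds z] fun w => 2 * L w := by
    filter_upwards [h1] with w hw
    have hl : HasDerivAt (fun t : ℝ => (w.1, t • w.2)) (0, w.2) 1 := by
      simpa using (hasDerivAt_const (1 : ℝ) w.1).prodMk ((hasDerivAt_id (1 : ℝ)).smul_const w.2)
    have hf : HasFDerivAt L (fderiv ℝ L w) (w.1, (1 : ℝ) • w.2) := by
      simpa using (hw.differentiableAt (by simp)).hasFDerivAt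
    have hA := hf.comp_hasDerivAt (1 : ℝ) hl
    have hB : HasDerivAt (fun t : ℝ => t ^ 2 * L w) (2 * L w) 1 := by
      simpa using (hasDerivAt_pow (𝕜 := ℝ) 2 1).mul_const (L w)
    refine hA.unique (hB.congr_of_eventuallyEq ?_)
    filter_upwards [lt_mem_nhds one_pos] with t ht
    exact hom w.1 w.2 t ht
  have h3 := h2.fderiv_eq (𝕜 := ℝ)
  have h4 : HasFDerivAt (fun w : Rn n × Rn n => ((0 : Rn n), w.2))
      ((0 : Rn n × Rn n →L[ℝ] Rn n).prod (ContinuousLinearMap.snd ℝ (Rn n) (Rn n))) z :=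
    (hasFDerivAt_const _ z).prodMk hasFDerivAt_snd
  have h5 := ((differentiableAt_fderiv hL).hasFDerivAt.clm_apply h4).fderiv
  have h6 : fderiv ℝ (fun w => 2 * L w) z = (2 : ℝ) • fderiv ℝ L z := by
    simpa using fderiv_const_mul (hL.differentiableAt (by simp)) (2 : ℝ)
  rw [h5, h6] at h3
  have h7 := congrArg (fun T => T ((0 : Rn n), EuclideanSpace.single a (1 : ℝ))) h3
  simp only [_root_.add_apply, ContinuousLinearMap.comp_apply,
    ContinuousLinearMap.flip_apply, ContinuousLinearMap.prod_apply, _root_.zero_apply,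
    ContinuousLinearMap.coe_snd', _root_.smul_apply, smul_eq_mul,
    fderiv_fderiv_vert hL] at h7
  have h8 : ∑ b, ∑ c, gMat L z b c * ((EuclideanSpace.single a (1 : ℝ) : Rn n) b * z.2 c) =
      ∑ u, gMat L z a u * z.2 u := by
    rw [Finset.sum_eq_single a]
    · simp
    · intro b _ hb; simp [hb]
    · simp
  rw [h8] at h7
  unfold pdy
  linarith

end CoordinateCalculus

section TangentCoordinates

/-! ### Charts of the tangent bundle -/

set_option linter.unusedSectionVars false

variable {n : ℕ} {N : Type*} [TopologicalSpace N] [ChartedSpace (Rn n) N]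
  [IsManifold (𝓡 n) ∞ N]

/-- The inverse of the coordinates `tcoord φ`. -/
noncomputable def tcoordInv (φ : OpenPartialHomeomorph N (Rn n)) (z : Rn n × Rn n) :
    TangentBundle (𝓡 n) N :=
  ⟨φ.symm z.1, mfderiv (𝓡 n) (𝓡 n) φ.symm z.1 z.2⟩

theorem sqLoc_eq (F : TangentBundle (𝓡 n) N → ℝ) (φ : OpenPartialHomeomorph N (Rn n))
    (z : Rn n × Rn n) : sqLoc F φ z = F (tcoordInv φ z) ^ 2 := rfl

theorem contMDiffOn_tcoord {φ : OpenPartialHomeomorph N (Rn n)}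
    (hφ : φ ∈ IsManifold.maximalAtlas (𝓡 n) ∞ N) :
    ContMDiffOn (𝓡 n).tangent 𝓘(ℝ, Rn n × Rn n) ∞ (tcoord φ) {q | q.1 ∈ φ.source} := by
  have h := contMDiffOn_of_mem_maximalAtlas hφ
  have h1 := h.contMDiffOn_tangentMapWithin (m := ∞) (by simp) φ.open_source.uniqueMDiffOn
  have h2 : ContMDiffOn (𝓡 n).tangent (𝓡 n).tangent ∞ (tangentMap (𝓡 n) (𝓡 n) φ)
      {q : TangentBundle (𝓡 n) N | q.1 ∈ φ.source} := by
    refine h1.congr fun q hq => ?_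
    rw [tangentMapWithin, tangentMap, mfderivWithin_of_isOpen φ.open_source hq]
  have h3 := (contMDiff_snd_tangentBundle_modelSpace (n := ∞) (Rn n) (𝓡 n)).comp_contMDiffOn h2
  have h4 : ContMDiffOn (𝓡 n).tangent (𝓡 n) ∞ (fun q : TangentBundle (𝓡 n) N => φ q.1)
      {q : TangentBundle (𝓡 n) N | q.1 ∈ φ.source} :=
    h.comp (Bundle.contMDiff_proj (TangentSpace (𝓡 n))).contMDiffOn fun q hq => hq
  exact h4.prodMk_space h3

theorem contMDiff_mk_tangentBundle_modelSpace :
    ContMDiff 𝓘(ℝ, Rn n × Rn n) (𝓡 n).tangent ∞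
      (fun z : Rn n × Rn n => (⟨z.1, z.2⟩ : TangentBundle (𝓡 n) (Rn n))) := by
  intro z
  rw [Bundle.contMDiffAt_totalSpace]
  refine ⟨contMDiff_iff_contDiff.2 contDiff_fst |>.contMDiffAt, ?_⟩
  have h : ContMDiffAt 𝓘(ℝ, Rn n × Rn n) 𝓘(ℝ, Rn n) ∞ (fun z : Rn n × Rn n => z.2) z :=
    (contMDiff_iff_contDiff.2 contDiff_snd).contMDiffAt
  simpa using h

theorem contMDiffOn_tcoordInv {φ : OpenPartialHomeomorph N (Rn n)}
    (hφ : φ ∈ IsManifold.maximalAtlas (𝓡 n) ∞ N) :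
    ContMDiffOn 𝓘(ℝ, Rn n × Rn n) (𝓡 n).tangent ∞ (tcoordInv φ) {z | z.1 ∈ φ.target} := by
  have h := contMDiffOn_symm_of_mem_maximalAtlas hφ
  have h1 := h.contMDiffOn_tangentMapWithin (m := ∞) (by simp) φ.open_target.uniqueMDiffOn
  refine (h1.comp contMDiff_mk_tangentBundle_modelSpace.contMDiffOn fun z hz => hz).congr
    fun z hz => ?_
  simp only [Function.comp, tangentMapWithin]
  rw [mfderivWithin_of_isOpen φ.open_target hz]
  rfl

theorem chart_mdifferentiable {φ : OpenPartialHomeomorph N (Rn n)}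
    (hφ : φ ∈ IsManifold.maximalAtlas (𝓡 n) ∞ N) : φ.MDifferentiable (𝓡 n) (𝓡 n) :=
  ⟨(contMDiffOn_of_mem_maximalAtlas hφ).mdifferentiableOn (by simp),
    (contMDiffOn_symm_of_mem_maximalAtlas hφ).mdifferentiableOn (by simp)⟩

theorem tcoordInv_tcoord {φ : OpenPartialHomeomorph N (Rn n)}
    (hφ : φ ∈ IsManifold.maximalAtlas (𝓡 n) ∞ N) {q : TangentBundle (𝓡 n) N}
    (hq : q.1 ∈ φ.source) : tcoordInv φ (tcoord φ q) = q := by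
  obtain ⟨x, v⟩ := q
  have h : ∀ (y : N) (w : Rn n), y = x → w = v → (⟨y, w⟩ : TangentBundle (𝓡 n) N) = ⟨x, v⟩ := by
    rintro y w rfl rfl
    rfl
  refine h _ _ (φ.left_inv hq) ?_
  exact congrArg (fun T => T v) ((chart_mdifferentiable hφ).symm_comp_deriv hq)

theorem tcoord_tcoordInv {φ : OpenPartialHomeomorph N (Rn n)}
    (hφ : φ ∈ IsManifold.maximalAtlas (𝓡 n) ∞ N) {z : Rn n × Rn n}
    (hz : z.1 ∈ φ.target) : tcoord φ (tcoordInv φ z) = z := by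
  refine Prod.ext (φ.right_inv hz) ?_
  exact congrArg (fun T => T z.2) ((chart_mdifferentiable hφ).comp_symm_deriv hz)

/-- The coordinates `(x, y)` induced by a chart of the smooth structure, as a local homeomorphism
of `TN`. -/
noncomputable def tcoordHomeo {φ : OpenPartialHomeomorph N (Rn n)}
    (hφ : φ ∈ IsManifold.maximalAtlas (𝓡 n) ∞ N) :
    OpenPartialHomeomorph (TangentBundle (𝓡 n) N) (Rn n × Rn n) where
  toFun := tcoord φ
  invFun := tcoordInv φ
  source := {q | q.1 ∈ φ.source}
  target := {z | z.1 ∈ φ.target}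
  map_source' _ hq := φ.map_source hq
  map_target' _ hz := φ.map_target hz
  left_inv' _ hq := tcoordInv_tcoord hφ hq
  right_inv' _ hz := tcoord_tcoordInv hφ hz
  open_source := φ.open_source.preimage (FiberBundle.continuous_proj _ _)
  open_target := φ.open_target.preimage continuous_fst
  continuousOn_toFun := (contMDiffOn_tcoord hφ).continuousOn
  continuousOn_invFun := (contMDiffOn_tcoordInv hφ).continuousOn

theorem tcoordHomeo_mdifferentiable {φ : OpenPartialHomeomorph N (Rn n)}
    (hφ : φ ∈ IsManifold.maximalAtlas (𝓡 n) ∞ N) :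
    (tcoordHomeo hφ).MDifferentiable (𝓡 n).tangent 𝓘(ℝ, Rn n × Rn n) :=
  ⟨(contMDiffOn_tcoord hφ).mdifferentiableOn (by simp),
    (contMDiffOn_tcoordInv hφ).mdifferentiableOn (by simp)⟩

/-- The differential of the coordinates `(x, y)` at a point of `TN`. -/
noncomputable abbrev tderiv (φ : OpenPartialHomeomorph N (Rn n)) (q : TangentBundle (𝓡 n) N) :
    TangentSpace (𝓡 n).tangent q →L[ℝ] Rn n × Rn n :=
  mfderiv (𝓡 n).tangent 𝓘(ℝ, Rn n × Rn n) (tcoord φ) q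

theorem isInvertible_tderiv {φ : OpenPartialHomeomorph N (Rn n)}
    (hφ : φ ∈ IsManifold.maximalAtlas (𝓡 n) ∞ N) {q : TangentBundle (𝓡 n) N}
    (hq : q.1 ∈ φ.source) : (tderiv φ q).IsInvertible :=
  ⟨(tcoordHomeo_mdifferentiable hφ).mfderiv (x := q) hq, rfl⟩

theorem tderiv_injective {φ : OpenPartialHomeomorph N (Rn n)}
    (hφ : φ ∈ IsManifold.maximalAtlas (𝓡 n) ∞ N) {q : TangentBundle (𝓡 n) N}
    (hq : q.1 ∈ φ.source) : Function.Injective (tderiv φ q) :=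
  (isInvertible_tderiv hφ hq).injective

theorem tderiv_inverse {φ : OpenPartialHomeomorph N (Rn n)}
    (hφ : φ ∈ IsManifold.maximalAtlas (𝓡 n) ∞ N) {q : TangentBundle (𝓡 n) N}
    (hq : q.1 ∈ φ.source) (w : Rn n × Rn n) : tderiv φ q ((tderiv φ q).inverse w) = w :=
  (isInvertible_tderiv hφ hq).self_apply_inverse w

theorem tcoord_snd_ne_zero {φ : OpenPartialHomeomorph N (Rn n)}
    (hφ : φ ∈ IsManifold.maximalAtlas (𝓡 n) ∞ N) {q : TangentBundle (𝓡 n) N}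
    (hq : q.1 ∈ φ.source) (h0 : q.2 ≠ 0) : (tcoord φ q).2 ≠ 0 := by
  intro h
  apply h0
  have h1 : q.2 = _ := (congrArg (fun T => T q.2)
    ((chart_mdifferentiable hφ).symm_comp_deriv hq)).symm
  rw [h1]
  change mfderiv (𝓡 n) (𝓡 n) φ.symm (φ q.1) (tcoord φ q).2 = 0
  rw [h]
  exact map_zero _

theorem eventually_mem_source_and_ne_zero {φ : OpenPartialHomeomorph N (Rn n)}
    (hφ : φ ∈ IsManifold.maximalAtlas (𝓡 n) ∞ N) {q : TangentBundle (𝓡 n) N}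
    (hq : q.1 ∈ φ.source) (h0 : q.2 ≠ 0) :
    ∀ᶠ r : TangentBundle (𝓡 n) N in nhds q, r.1 ∈ φ.source ∧ r.2 ≠ 0 := by
  have h1 : ∀ᶠ r : TangentBundle (𝓡 n) N in nhds q, r.1 ∈ φ.source :=
    (tcoordHomeo hφ).open_source.mem_nhds hq
  have h2 : ContinuousAt (fun r => (tcoord φ r).2) q :=
    continuous_snd.continuousAt.comp ((tcoordHomeo hφ).continuousAt hq)
  filter_upwards [h1, h2.eventually_ne (tcoord_snd_ne_zero hφ hq h0)] with r hr hr2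
  refine ⟨hr, fun h => hr2 ?_⟩
  simp only [tcoord, h, map_zero]
  rfl

theorem isRegularAt_sqLoc {F : TangentBundle (𝓡 n) N → ℝ} (hF : IsFinsler F)
    {φ : OpenPartialHomeomorph N (Rn n)}
    (hφ : φ ∈ IsManifold.maximalAtlas (𝓡 n) ∞ N) {q : TangentBundle (𝓡 n) N}
    (hq : q.1 ∈ φ.source) (h0 : q.2 ≠ 0) : IsRegularAt (sqLoc F φ) (tcoord φ q) := by
  refine ⟨?_, hF.posDef φ hφ _ (φ.map_source hq) (tcoord_snd_ne_zero hφ hq h0)⟩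
  have hF1 : ContMDiffAt (𝓡 n).tangent 𝓘(ℝ, ℝ) ∞ F (tcoordInv φ (tcoord φ q)) := by
    rw [tcoordInv_tcoord hφ hq]
    exact hF.smooth.contMDiffAt (Filter.mem_of_superset
      (eventually_mem_source_and_ne_zero hφ hq h0) fun r hr => hr.2)
  have h1 : ContMDiffAt 𝓘(ℝ, Rn n × Rn n) (𝓡 n).tangent ∞ (tcoordInv φ) (tcoord φ q) :=
    (contMDiffOn_tcoordInv hφ).contMDiffAt
      ((tcoordHomeo hφ).open_target.mem_nhds (φ.map_source hq))
  exact (contMDiffAt_iff_contDiffAt.1 (hF1.comp _ h1)).pow 2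

theorem eventually_isRegularAt_sqLoc {F : TangentBundle (𝓡 n) N → ℝ} (hF : IsFinsler F)
    {φ : OpenPartialHomeomorph N (Rn n)}
    (hφ : φ ∈ IsManifold.maximalAtlas (𝓡 n) ∞ N) {q : TangentBundle (𝓡 n) N}
    (hq : q.1 ∈ φ.source) (h0 : q.2 ≠ 0) :
    ∀ᶠ z in nhds (tcoord φ q), IsRegularAt (sqLoc F φ) z := by
  have h1 : ContinuousAt (tcoordInv φ) (tcoord φ q) :=
    (tcoordHomeo hφ).continuousAt_symm (φ.map_source hq)
  have h2 := eventually_mem_source_and_ne_zero hφ hq h0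
  rw [← tcoordInv_tcoord hφ hq] at h2
  filter_upwards [h1.eventually h2,
    (tcoordHomeo hφ).open_target.mem_nhds (φ.map_source hq)] with z hz hz'
  rw [← tcoord_tcoordInv hφ hz']
  exact isRegularAt_sqLoc hF hφ hz.1 hz.2

theorem sqLoc_homogeneous {F : TangentBundle (𝓡 n) N → ℝ} (hF : IsFinsler F)
    (φ : OpenPartialHomeomorph N (Rn n)) (x y : Rn n) (t : ℝ) (ht : 0 < t) :
    sqLoc F φ (x, t • y) = t ^ 2 * sqLoc F φ (x, y) := by
  simp only [sqLoc]
  rw [← mul_pow, ← hF.homogeneous _ _ t ht]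
  congr 2
  exact congrArg _ (map_smul (mfderiv (𝓡 n) (𝓡 n) φ.symm x) t y)

/-! ### Change of chart -/

theorem contDiffAt_transition {φ ψ : OpenPartialHomeomorph N (Rn n)}
    (hφ : φ ∈ IsManifold.maximalAtlas (𝓡 n) ∞ N) (hψ : ψ ∈ IsManifold.maximalAtlas (𝓡 n) ∞ N)
    {x : N} (hx : x ∈ φ.source) (hx' : x ∈ ψ.source) :
    ContDiffAt ℝ ∞ (ψ ∘ φ.symm) (φ x) := by
  refine contMDiffAt_iff_contDiffAt.1 ?_
  refine ContMDiffAt.comp (I' := 𝓡 n) (φ x) ?_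
    (contMDiffAt_symm_of_mem_maximalAtlas hφ (φ.map_source hx))
  rw [φ.left_inv hx]
  exact contMDiffAt_of_mem_maximalAtlas hψ hx'

/-- The chain rule `Dψ = D(ψ ∘ φ⁻¹) Dφ`, with the differential of the transition map taken in
`Rⁿ`. -/
theorem mfderiv_chart_eq {φ ψ : OpenPartialHomeomorph N (Rn n)}
    (hφ : φ ∈ IsManifold.maximalAtlas (𝓡 n) ∞ N) (hψ : ψ ∈ IsManifold.maximalAtlas (𝓡 n) ∞ N)
    {x : N} (hx : x ∈ φ.source) (hx' : x ∈ ψ.source) (v : TangentSpace (𝓡 n) x) :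
    (mfderiv (𝓡 n) (𝓡 n) ψ x v : Rn n) =
      fderiv ℝ (ψ ∘ φ.symm) (φ x) (mfderiv (𝓡 n) (𝓡 n) φ x v) := by
  have h1 : ψ =ᶠ[nhds x] (ψ ∘ φ.symm) ∘ φ := by
    filter_upwards [φ.open_source.mem_nhds hx] with y hy
    simp [φ.left_inv hy]
  have h2 : MDifferentiableAt (𝓡 n) (𝓡 n) (ψ ∘ φ.symm) (φ x) :=
    mdifferentiableAt_iff_differentiableAt.2
      ((contDiffAt_transition hφ hψ hx hx').differentiableAt (by simp))
  have h3 : MDifferentiableAt (𝓡 n) (𝓡 n) φ x := (chart_mdifferentiable hφ).mdifferentiableAt hx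
  rw [← mfderiv_eq_fderiv]
  have h4 : (mfderiv (𝓡 n) (𝓡 n) ψ x v : Rn n) =
      mfderiv (𝓡 n) (𝓡 n) ((ψ ∘ φ.symm) ∘ φ) x v :=
    congrArg (fun T : Rn n →L[ℝ] Rn n => T v) h1.mfderiv_eq
  exact h4.trans (mfderiv_comp_apply x h2 h3 v)

theorem tcoord_eq_tangentLift {φ ψ : OpenPartialHomeomorph N (Rn n)}
    (hφ : φ ∈ IsManifold.maximalAtlas (𝓡 n) ∞ N) (hψ : ψ ∈ IsManifold.maximalAtlas (𝓡 n) ∞ N)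
    {q : TangentBundle (𝓡 n) N} (hq : q.1 ∈ φ.source) (hq' : q.1 ∈ ψ.source) :
    tcoord ψ q = tangentLift (ψ ∘ φ.symm) (tcoord φ q) := by
  refine Prod.ext ?_ (mfderiv_chart_eq hφ hψ hq hq' q.2)
  simp [tcoord, tangentLift, φ.left_inv hq]

theorem fderiv_transition_surjective {φ ψ : OpenPartialHomeomorph N (Rn n)}
    (hφ : φ ∈ IsManifold.maximalAtlas (𝓡 n) ∞ N) (hψ : ψ ∈ IsManifold.maximalAtlas (𝓡 n) ∞ N)
    {x : N} (hx : x ∈ φ.source) (hx' : x ∈ ψ.source) :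
    Function.Surjective (fderiv ℝ (ψ ∘ φ.symm) (φ x)) := by
  intro w
  obtain ⟨v, hv⟩ := (chart_mdifferentiable hψ).mfderiv_surjective hx' w
  exact ⟨_, (mfderiv_chart_eq hφ hψ hx hx' v).symm.trans hv⟩

theorem sqLoc_eventuallyEq (F : TangentBundle (𝓡 n) N → ℝ)
    {φ ψ : OpenPartialHomeomorph N (Rn n)}
    (hφ : φ ∈ IsManifold.maximalAtlas (𝓡 n) ∞ N) (hψ : ψ ∈ IsManifold.maximalAtlas (𝓡 n) ∞ N)
    {q : TangentBundle (𝓡 n) N} (hq : q.1 ∈ φ.source) (hq' : q.1 ∈ ψ.source) :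
    sqLoc F φ =ᶠ[nhds (tcoord φ q)] sqLoc F ψ ∘ tangentLift (ψ ∘ φ.symm) := by
  have h1 : ContinuousAt (tcoordInv φ) (tcoord φ q) :=
    (tcoordHomeo hφ).continuousAt_symm (φ.map_source hq)
  have h2 : ∀ᶠ r : TangentBundle (𝓡 n) N in nhds (tcoordInv φ (tcoord φ q)), r.1 ∈ ψ.source := by
    rw [tcoordInv_tcoord hφ hq]
    exact (tcoordHomeo hψ).open_source.mem_nhds hq'
  filter_upwards [h1.eventually h2,
    (tcoordHomeo hφ).open_target.mem_nhds (φ.map_source hq)] with z hz hz'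
  have h3 := tcoord_eq_tangentLift hφ hψ (q := tcoordInv φ z) (φ.map_target hz') hz
  rw [tcoord_tcoordInv hφ hz'] at h3
  rw [Function.comp_apply, ← h3, sqLoc_eq, sqLoc_eq, tcoordInv_tcoord hψ hz]

theorem eventually_isRegularAt_tangentLift {F : TangentBundle (𝓡 n) N → ℝ} (hF : IsFinsler F)
    {φ ψ : OpenPartialHomeomorph N (Rn n)}
    (hφ : φ ∈ IsManifold.maximalAtlas (𝓡 n) ∞ N) (hψ : ψ ∈ IsManifold.maximalAtlas (𝓡 n) ∞ N)
    {q : TangentBundle (𝓡 n) N} (hq : q.1 ∈ φ.source) (hq' : q.1 ∈ ψ.source) (h0 : q.2 ≠ 0) :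
    ∀ᶠ z in nhds (tcoord φ q),
      IsRegularAt (sqLoc F ψ) (tangentLift (ψ ∘ φ.symm) z) := by
  have h1 : ContinuousAt (tangentLift (ψ ∘ φ.symm)) (tcoord φ q) :=
    (hasFDerivAt_tangentLift (z := tcoord φ q)
      (contDiffAt_transition hφ hψ hq hq')).continuousAt
  refine h1.eventually ?_
  rw [← tcoord_eq_tangentLift hφ hψ hq hq']
  exact eventually_isRegularAt_sqLoc hF hψ hq' h0

theorem tderiv_eq_of_charts {φ ψ : OpenPartialHomeomorph N (Rn n)}
    (hφ : φ ∈ IsManifold.maximalAtlas (𝓡 n) ∞ N) (hψ : ψ ∈ IsManifold.maximalAtlas (𝓡 n) ∞ N)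
    {q : TangentBundle (𝓡 n) N} (hq : q.1 ∈ φ.source) (hq' : q.1 ∈ ψ.source)
    (u : TangentSpace (𝓡 n).tangent q) :
    tderiv ψ q u = (fderiv ℝ (ψ ∘ φ.symm) (φ q.1) (tderiv φ q u).1,
      fderiv ℝ (ψ ∘ φ.symm) (φ q.1) (tderiv φ q u).2 +
        fderiv ℝ (fderiv ℝ (ψ ∘ φ.symm)) (φ q.1) (tderiv φ q u).1 (tcoord φ q).2) := by
  have h1 : tcoord ψ =ᶠ[nhds q] tangentLift (ψ ∘ φ.symm) ∘ tcoord φ := by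
    filter_upwards [(tcoordHomeo hφ).open_source.mem_nhds hq,
      (tcoordHomeo hψ).open_source.mem_nhds hq'] with r hr hr'
    exact tcoord_eq_tangentLift hφ hψ hr hr'
  have hτ := contDiffAt_transition hφ hψ hq hq'
  have h2 : MDifferentiableAt 𝓘(ℝ, Rn n × Rn n) 𝓘(ℝ, Rn n × Rn n)
      (tangentLift (ψ ∘ φ.symm)) (tcoord φ q) :=
    mdifferentiableAt_iff_differentiableAt.2
      (hasFDerivAt_tangentLift (z := tcoord φ q) hτ).differentiableAt
  have h3 : MDifferentiableAt (𝓡 n).tangent 𝓘(ℝ, Rn n × Rn n) (tcoord φ) q :=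
    (tcoordHomeo_mdifferentiable hφ).mdifferentiableAt hq
  have h4 : tderiv ψ q u = mfderiv (𝓡 n).tangent 𝓘(ℝ, Rn n × Rn n)
      (tangentLift (ψ ∘ φ.symm) ∘ tcoord φ) q u :=
    congrArg (fun T : Rn n × Rn n →L[ℝ] Rn n × Rn n => T u) h1.mfderiv_eq
  have h5 := mfderiv_comp_apply q h2 h3 u
  rw [mfderiv_eq_fderiv] at h5
  refine (h4.trans h5).trans ?_
  exact (fderiv_tangentLift (z := tcoord φ q) hτ (tderiv φ q u))

end TangentCoordinates

section ChartIndependence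

variable {n : ℕ} {N : Type*} [TopologicalSpace N] [ChartedSpace (Rn n) N]
  [IsManifold (𝓡 n) ∞ N]

/-! ### Independence of the chart -/

/-- The vertical component `(δy^a(u))` of a tangent vector `u` of `TN`, in the coordinates of a
chart. -/
noncomputable def vertComp (F : TangentBundle (𝓡 n) N → ℝ) (φ : OpenPartialHomeomorph N (Rn n))
    (q : TangentBundle (𝓡 n) N) (u : TangentSpace (𝓡 n).tangent q) : Rn n :=
  (tderiv φ q u).2 + nonlinMap (sqLoc F φ) (tcoord φ q) (tderiv φ q u).1

theorem dxForm_apply (φ : OpenPartialHomeomorph N (Rn n)) (a : Fin n)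
    (q : TangentBundle (𝓡 n) N) (u : TangentSpace (𝓡 n).tangent q) :
    dxForm φ a q u = (tderiv φ q u).1 a := rfl

theorem deltayForm_apply (F : TangentBundle (𝓡 n) N → ℝ) (φ : OpenPartialHomeomorph N (Rn n))
    (a : Fin n) (q : TangentBundle (𝓡 n) N) (u : TangentSpace (𝓡 n).tangent q) :
    deltayForm F φ a q u = vertComp F φ q u a := by
  simp only [deltayForm, LinearMap.add_apply, LinearMap.sum_apply, LinearMap.smul_apply,
    dxForm_apply, vertComp, PiLp.add_apply, nonlinMap_apply, smul_eq_mul]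
  rfl

theorem tderiv_vertField {φ : OpenPartialHomeomorph N (Rn n)}
    (hφ : φ ∈ IsManifold.maximalAtlas (𝓡 n) ∞ N) {q : TangentBundle (𝓡 n) N}
    (hq : q.1 ∈ φ.source) (a : Fin n) :
    tderiv φ q (vertField φ a q) = (0, EuclideanSpace.single a 1) :=
  tderiv_inverse hφ hq _

theorem tderiv_horField (F : TangentBundle (𝓡 n) N → ℝ) {φ : OpenPartialHomeomorph N (Rn n)}
    (hφ : φ ∈ IsManifold.maximalAtlas (𝓡 n) ∞ N) {q : TangentBundle (𝓡 n) N}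
    (hq : q.1 ∈ φ.source) (a : Fin n) :
    tderiv φ q (horField F φ a q) = (EuclideanSpace.single a 1,
      -nonlinMap (sqLoc F φ) (tcoord φ q) (EuclideanSpace.single a 1)) := by
  refine (tderiv_inverse hφ hq _).trans (Prod.ext rfl (congrArg Neg.neg ?_))
  ext b
  simp [Finset.sum_apply, Pi.single_apply]

/-- The components `δy^a(u)` transform as a vector tangent to `N`, by the transformation law of the
nonlinear connection. -/
theorem vertComp_eq_of_charts {F : TangentBundle (𝓡 n) N → ℝ} (hF : IsFinsler F)
    {φ ψ : OpenPartialHomeomorph N (Rn n)}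
    (hφ : φ ∈ IsManifold.maximalAtlas (𝓡 n) ∞ N) (hψ : ψ ∈ IsManifold.maximalAtlas (𝓡 n) ∞ N)
    {q : TangentBundle (𝓡 n) N} (hq : q.1 ∈ φ.source) (hq' : q.1 ∈ ψ.source) (h0 : q.2 ≠ 0)
    (u : TangentSpace (𝓡 n).tangent q) :
    vertComp F ψ q u = fderiv ℝ (ψ ∘ φ.symm) (φ q.1) (vertComp F φ q u) := by
  have h := nonlinMap_comp_tangentLift (z := tcoord φ q) (contDiffAt_transition hφ hψ hq hq')
    (fderiv_transition_surjective hφ hψ hq hq') (eventually_isRegularAt_sqLoc hF hφ hq h0)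
    (eventually_isRegularAt_tangentLift hF hφ hψ hq hq' h0)
    (sqLoc_eventuallyEq F hφ hψ hq hq') (tderiv φ q u).1
  rw [← tcoord_eq_tangentLift hφ hψ hq hq'] at h
  change _ = fderiv ℝ (ψ ∘ φ.symm) (φ q.1) _ -
    fderiv ℝ (fderiv ℝ (ψ ∘ φ.symm)) (φ q.1) _ _ at h
  unfold vertComp
  rw [tderiv_eq_of_charts hφ hψ hq hq' u, map_add]
  dsimp only
  change _ + nonlinMap (sqLoc F ψ) (tcoord ψ q) (fderiv ℝ (ψ ∘ φ.symm) (φ q.1) _) = _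
  refine (congrArg (fun v => _ + v) h).trans ?_
  abel

/-- `vertProj` in the coordinates of an arbitrary chart, not just the preferred one. -/
theorem tderiv_vertProj {F : TangentBundle (𝓡 n) N → ℝ} (hF : IsFinsler F)
    {φ : OpenPartialHomeomorph N (Rn n)} (hφ : φ ∈ IsManifold.maximalAtlas (𝓡 n) ∞ N)
    {q : TangentBundle (𝓡 n) N} (hq : q.1 ∈ φ.source) (h0 : q.2 ≠ 0)
    (u : TangentSpace (𝓡 n).tangent q) :
    tderiv φ q (vertProj F q u) = (0, vertComp F φ q u) := by
  have hψ := IsManifold.chart_mem_maximalAtlas (I := 𝓡 n) (n := ∞) q.1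
  have hq' := mem_chart_source (Rn n) q.1
  have h1 : tderiv (chartAt (Rn n) q.1) q (vertProj F q u) =
      (0, vertComp F (chartAt (Rn n) q.1) q u) := by
    simp only [vertProj, LinearMap.sum_apply, LinearMap.smulRight_apply, map_sum, map_smul,
      tderiv_vertField hψ hq', deltayForm_apply]
    ext1
    · simp [Prod.fst_sum]
    · simp [Prod.snd_sum, sum_smul_single]
  rw [tderiv_eq_of_charts hψ hφ hq' hq, h1, vertComp_eq_of_charts hF hψ hφ hq' hq h0]
  simp

/-- `horProj` in the coordinates of an arbitrary chart. -/
theorem tderiv_horProj {F : TangentBundle (𝓡 n) N → ℝ} (hF : IsFinsler F)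
    {φ : OpenPartialHomeomorph N (Rn n)} (hφ : φ ∈ IsManifold.maximalAtlas (𝓡 n) ∞ N)
    {q : TangentBundle (𝓡 n) N} (hq : q.1 ∈ φ.source) (h0 : q.2 ≠ 0)
    (u : TangentSpace (𝓡 n).tangent q) :
    tderiv φ q (horProj F q u) = ((tderiv φ q u).1,
      -nonlinMap (sqLoc F φ) (tcoord φ q) (tderiv φ q u).1) := by
  have hψ := IsManifold.chart_mem_maximalAtlas (I := 𝓡 n) (n := ∞) q.1
  have hq' := mem_chart_source (Rn n) q.1
  have h1 : tderiv (chartAt (Rn n) q.1) q (horProj F q u) =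
      ((tderiv (chartAt (Rn n) q.1) q u).1, -nonlinMap (sqLoc F (chartAt (Rn n) q.1))
        (tcoord (chartAt (Rn n) q.1) q) (tderiv (chartAt (Rn n) q.1) q u).1) := by
    simp only [horProj, LinearMap.sum_apply, LinearMap.smulRight_apply, map_sum, map_smul,
      tderiv_horField F hψ hq', dxForm_apply]
    ext1
    · simp only [Prod.fst_sum, Prod.smul_fst, sum_smul_single]
    · simp only [Prod.snd_sum, Prod.smul_snd, smul_neg, Finset.sum_neg_distrib, ← map_smul,
        ← map_sum, sum_smul_single]
  have h2 : vertComp F φ q (horProj F q u) = 0 := by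
    rw [vertComp_eq_of_charts hF hψ hφ hq' hq h0, vertComp, h1]
    simp
  have h3 : (tderiv φ q (horProj F q u)).1 = (tderiv φ q u).1 := by
    rw [tderiv_eq_of_charts hψ hφ hq' hq, h1, tderiv_eq_of_charts hψ hφ hq' hq]
  refine Prod.ext h3 ?_
  rw [vertComp, h3] at h2
  exact eq_neg_of_add_eq_zero_left h2

/-- The Sasaki-Finsler metric in the coordinates of an arbitrary chart. -/
theorem sasaki_apply {F : TangentBundle (𝓡 n) N → ℝ} (hF : IsFinsler F)
    {φ : OpenPartialHomeomorph N (Rn n)} (hφ : φ ∈ IsManifold.maximalAtlas (𝓡 n) ∞ N)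
    {q : TangentBundle (𝓡 n) N} (hq : q.1 ∈ φ.source) (h0 : q.2 ≠ 0)
    (u v : TangentSpace (𝓡 n).tangent q) :
    sasaki F q u v =
      ∑ a, ∑ b, gMat (sqLoc F φ) (tcoord φ q) a b * ((tderiv φ q u).1 a * (tderiv φ q v).1 b)
      + ∑ a, ∑ b, gMat (sqLoc F φ) (tcoord φ q) a b *
          (vertComp F φ q u a * vertComp F φ q v b) := by
  have hψ := IsManifold.chart_mem_maximalAtlas (I := 𝓡 n) (n := ∞) q.1
  have hq' := mem_chart_source (Rn n) q.1
  have hg : ∀ v w : Rn n, _ := sum_gMat_comp_tangentLift (z := tcoord (chartAt (Rn n) q.1) q)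
    (contDiffAt_transition hψ hφ hq' hq) (isRegularAt_sqLoc hF hψ hq' h0).smooth
    (eventually_isRegularAt_tangentLift hF hψ hφ hq' hq h0).self_of_nhds.smooth
    (sqLoc_eventuallyEq F hψ hφ hq' hq)
  rw [← tcoord_eq_tangentLift hψ hφ hq' hq] at hg
  rw [vertComp_eq_of_charts hF hψ hφ hq' hq h0, vertComp_eq_of_charts hF hψ hφ hq' hq h0,
    tderiv_eq_of_charts hψ hφ hq' hq u, tderiv_eq_of_charts hψ hφ hq' hq v]
  refine Eq.trans ?_ (congrArg₂ (· + ·) (hg _ _) (hg _ _)).symm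
  simp only [sasaki, LinearMap.sum_apply, LinearMap.smul_apply, LinearMap.add_apply,
    LinearMap.BilinForm.linMulLin_apply, dxForm_apply, deltayForm_apply, smul_eq_mul, mul_add,
    Finset.sum_add_distrib]

/-- The Cartan form in the coordinates of an arbitrary chart. -/
theorem cartanForm_apply {F : TangentBundle (𝓡 n) N → ℝ} (hF : IsFinsler F)
    {φ : OpenPartialHomeomorph N (Rn n)} (hφ : φ ∈ IsManifold.maximalAtlas (𝓡 n) ∞ N)
    {q : TangentBundle (𝓡 n) N} (hq : q.1 ∈ φ.source) (h0 : q.2 ≠ 0)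
    (u : TangentSpace (𝓡 n).tangent q) :
    cartanForm F q u =
      (1 / 2) * fderiv ℝ (sqLoc F φ) (tcoord φ q) (0, (tderiv φ q u).1) := by
  have hψ := IsManifold.chart_mem_maximalAtlas (I := 𝓡 n) (n := ∞) q.1
  have hq' := mem_chart_source (Rn n) q.1
  have h1 := fderiv_comp_tangentLift (z := tcoord (chartAt (Rn n) q.1) q)
    (contDiffAt_transition hψ hφ hq' hq)
    ((eventually_isRegularAt_tangentLift hF hψ hφ hq' hq h0).self_of_nhds.smooth.differentiableAt
      (by simp))
    (sqLoc_eventuallyEq F hψ hφ hq' hq) (0, (tderiv (chartAt (Rn n) q.1) q u).1)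
  rw [← tcoord_eq_tangentLift hψ hφ hq' hq] at h1
  simp only [map_zero, _root_.zero_apply, add_zero] at h1
  rw [tderiv_eq_of_charts hψ hφ hq' hq u]
  refine Eq.trans ?_ (congrArg (fun t => (1 / 2 : ℝ) * t) h1)
  rw [clm_snd_eq_sum, Finset.mul_sum]
  simp only [cartanForm, LinearMap.sum_apply, LinearMap.smul_apply, dxForm_apply, smul_eq_mul]
  refine Finset.sum_congr rfl fun a _ => ?_
  unfold pdy
  ring

end ChartIndependence

section KoszulTensoriality

variable {E : Type*} [NormedAddCommGroup E] [NormedSpace ℝ E]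
  {H : Type*} [TopologicalSpace H] {I : ModelWithCorners ℝ E H}
  {M : Type*} [TopologicalSpace M] [ChartedSpace H M]

/-! ### Locality and tensoriality of the Koszul expression -/

theorem dirDeriv_add {X : Π p : M, TangentSpace I p} {f g : M → ℝ} {p : M}
    (hf : MDifferentiableAt I 𝓘(ℝ, ℝ) f p) (hg : MDifferentiableAt I 𝓘(ℝ, ℝ) g p) :
    dirDeriv I X (fun q => f q + g q) p = dirDeriv I X f p + dirDeriv I X g p := by
  have h := (hf.hasMFDerivAt.add hg.hasMFDerivAt).mfderiv
  exact congrArg (fun T : TangentSpace I p →L[ℝ] ℝ => T (X p)) h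

theorem dirDeriv_mul {X : Π p : M, TangentSpace I p} {f g : M → ℝ} {p : M}
    (hf : MDifferentiableAt I 𝓘(ℝ, ℝ) f p) (hg : MDifferentiableAt I 𝓘(ℝ, ℝ) g p) :
    dirDeriv I X (fun q => f q * g q) p = f p * dirDeriv I X g p + g p * dirDeriv I X f p := by
  have h := (hf.hasMFDerivAt.mul hg.hasMFDerivAt).mfderiv
  exact congrArg (fun T : TangentSpace I p →L[ℝ] ℝ => T (X p)) h

theorem dirDeriv_congr {X X' : Π p : M, TangentSpace I p} {f g : M → ℝ} {p : M}
    (hX : X p = X' p) (h : f =ᶠ[nhds p] g) : dirDeriv I X f p = dirDeriv I X' g p := by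
  unfold dirDeriv
  rw [hX]
  exact congrArg (fun T : TangentSpace I p →L[ℝ] ℝ => T (X' p)) h.mfderiv_eq

theorem dirDeriv_zero_fun (X : Π p : M, TangentSpace I p) (p : M) :
    dirDeriv I X (fun _ => 0) p = 0 := by
  unfold dirDeriv
  exact congrArg (fun T : TangentSpace I p →L[ℝ] ℝ => T (X p)) (mfderiv_const (c := (0 : ℝ)))

variable {G : Π p : M, LinearMap.BilinForm ℝ (TangentSpace I p)}
  {W : Π p : M, Module.Dual ℝ (TangentSpace I p)}

/-- The Koszul expression at `p` depends only on the germs of the fields at `p`. -/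
theorem koszul_congr {X X' Y Y' Z Z' : Π p : M, TangentSpace I p} {p : M}
    (hX : ∀ᶠ q in nhds p, X q = X' q) (hY : ∀ᶠ q in nhds p, Y q = Y' q)
    (hZ : ∀ᶠ q in nhds p, Z q = Z' q) : koszul I G W X Y Z p = koszul I G W X' Y' Z' p := by
  have hf : ∀ {A A' B B' : Π p : M, TangentSpace I p}, (∀ᶠ q in nhds p, A q = A' q) →
      (∀ᶠ q in nhds p, B q = B' q) →
      (fun q => G q (A q) (B q)) =ᶠ[nhds p] fun q => G q (A' q) (B' q) := by
    intro A A' B B' hA hB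
    filter_upwards [hA, hB] with q h1 h2
    rw [h1, h2]
  have b1 := Filter.EventuallyEq.mlieBracket_vectorField_eq (I := I) hX hY
  have b2 := Filter.EventuallyEq.mlieBracket_vectorField_eq (I := I) hY hZ
  have b3 := Filter.EventuallyEq.mlieBracket_vectorField_eq (I := I) hZ hX
  unfold koszul
  rw [dirDeriv_congr hX.self_of_nhds (hf hY hZ), dirDeriv_congr hY.self_of_nhds (hf hZ hX),
    dirDeriv_congr hZ.self_of_nhds (hf hX hY), b1, b2, b3, hX.self_of_nhds, hY.self_of_nhds,
    hZ.self_of_nhds]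

theorem koszul_zero_left (Y Z : Π p : M, TangentSpace I p) (p : M) :
    koszul I G W 0 Y Z p = 0 := by
  have h1 : dirDeriv I (0 : Π p : M, TangentSpace I p) (fun q => G q (Y q) (Z q)) p = 0 :=
    map_zero _
  simp [koszul, h1, dirDeriv_zero_fun]

theorem koszul_zero_middle (X Z : Π p : M, TangentSpace I p) (p : M) :
    koszul I G W X 0 Z p = 0 := by
  have h1 : dirDeriv I (0 : Π p : M, TangentSpace I p) (fun q => G q (Z q) (X q)) p = 0 :=
    map_zero _
  simp [koszul, h1, dirDeriv_zero_fun]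

theorem weylConnection_congr [IsManifold I 1 M] {X X' Y Y' : Π p : M, TangentSpace I p} {p : M}
    (hX : ∀ᶠ q in nhds p, X q = X' q) (hY : ∀ᶠ q in nhds p, Y q = Y' q) :
    weylConnection I G W X Y p = weylConnection I G W X' Y' p := by
  have h : ∀ Z, koszul I G W X Y Z p = koszul I G W X' Y' Z p := fun Z =>
    koszul_congr hX hY (Filter.Eventually.of_forall fun _ => rfl)
  -- The definition of the connection, as a function of the Koszul expression.
  let w (K : (Π q : M, TangentSpace I q) → ℝ) : TangentSpace I p := open Classical in
    if h : ∃ w : TangentSpace I p, ∀ Z : Π q : M, TangentSpace I q,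
      MDifferentiableAt I I.tangent (fun q => (⟨q, Z q⟩ : TangentBundle I M)) p →
        2 * G p w (Z p) = K Z
    then h.choose else 0
  exact congrArg w (funext h)

theorem weylConnection_spec [IsManifold I 1 M] {X Y : Π p : M, TangentSpace I p} {p : M}
    (h : ∃ w : TangentSpace I p, ∀ Z : Π q : M, TangentSpace I q,
      MDifferentiableAt I I.tangent (fun q => (⟨q, Z q⟩ : TangentBundle I M)) p →
        2 * G p w (Z p) = koszul I G W X Y Z p)
    {Z : Π q : M, TangentSpace I q}
    (hZ : MDifferentiableAt I I.tangent (fun q => (⟨q, Z q⟩ : TangentBundle I M)) p) :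
    2 * G p (weylConnection I G W X Y p) (Z p) = koszul I G W X Y Z p := by
  unfold weylConnection
  rw [dif_pos h]
  exact h.choose_spec Z hZ

/-- The Koszul expression is tensorial in its last argument: the derivatives of a factor `f` of `Z`
cancel since `G` is symmetric. -/
theorem koszul_tensorialAt [IsManifold I 2 M] [CompleteSpace E]
    {X Y : Π p : M, TangentSpace I p} {p : M}
    (hsymm : ∀ u v : TangentSpace I p, G p u v = G p v u)
    (hY : ∀ Z : Π q : M, TangentSpace I q,
      MDifferentiableAt I I.tangent (fun q => (⟨q, Z q⟩ : TangentBundle I M)) p →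
        MDifferentiableAt I 𝓘(ℝ, ℝ) (fun q => G q (Y q) (Z q)) p)
    (hX : ∀ Z : Π q : M, TangentSpace I q,
      MDifferentiableAt I I.tangent (fun q => (⟨q, Z q⟩ : TangentBundle I M)) p →
        MDifferentiableAt I 𝓘(ℝ, ℝ) (fun q => G q (Z q) (X q)) p) :
    TensorialAt I E (fun Z : Π q : M, TangentSpace I q => koszul I G W X Y Z p) p where
  smul := by
    intro f Z hf hZ
    have d1 := dirDeriv_mul (X := X) hf (hY Z hZ)
    have d2 := dirDeriv_mul (X := Y) hf (hX Z hZ)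
    have d3 : dirDeriv I (f • Z) (fun q => G q (X q) (Y q)) p =
      f p * dirDeriv I Z (fun q => G q (X q) (Y q)) p :=
        map_smul (mfderiv I 𝓘(ℝ, ℝ) (fun q => G q (X q) (Y q)) p) (f p) (Z p)
    have b1 : VectorField.mlieBracket I Y (f • Z) p = dirDeriv I Y f p • Z p +
        f p • VectorField.mlieBracket I Y Z p := VectorField.mlieBracket_smul_right hf hZ
    have b2 : VectorField.mlieBracket I (f • Z) X p = -(dirDeriv I X f p) • Z p +
        f p • VectorField.mlieBracket I Z X p := VectorField.mlieBracket_smul_left hf hZ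
    have s := hsymm (Y p) (Z p)
    unfold koszul
    simp only [d3, b1, b2, Pi.smul_apply', map_smul, map_add, LinearMap.add_apply,
      LinearMap.smul_apply, smul_eq_mul, d1, d2, s]
    ring
  add := by
    intro Z Z' hZ hZ'
    have d1 := dirDeriv_add (X := X) (hY Z hZ) (hY Z' hZ')
    have d2 := dirDeriv_add (X := Y) (hX Z hZ) (hX Z' hZ')
    have d3 : dirDeriv I (Z + Z') (fun q => G q (X q) (Y q)) p =
      dirDeriv I Z (fun q => G q (X q) (Y q)) p + dirDeriv I Z' (fun q => G q (X q) (Y q)) p :=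
        map_add (mfderiv I 𝓘(ℝ, ℝ) (fun q => G q (X q) (Y q)) p) (Z p) (Z' p)
    have b1 : VectorField.mlieBracket I Y (Z + Z') p = VectorField.mlieBracket I Y Z p +
        VectorField.mlieBracket I Y Z' p := VectorField.mlieBracket_add_right hZ hZ'
    have b2 : VectorField.mlieBracket I (Z + Z') X p = VectorField.mlieBracket I Z X p +
        VectorField.mlieBracket I Z' X p := VectorField.mlieBracket_add_left hZ hZ'
    unfold koszul
    simp only [d3, b1, b2, Pi.add_apply, map_add, LinearMap.add_apply, d1, d2]
    ring

/-- If the Koszul expression is tensorial and `G` is nondegenerate at `p`, then the Weyl connection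
at `p` solves the generalized Koszul formula. -/
theorem weylConnection_koszul [IsManifold I 2 M] [CompleteSpace E] [FiniteDimensional ℝ E]
    {X Y : Π p : M, TangentSpace I p} {p : M}
    (hnd : ∀ u : TangentSpace I p, (∀ v, G p u v = 0) → u = 0)
    (ht : TensorialAt I E (fun Z : Π q : M, TangentSpace I q => koszul I G W X Y Z p) p)
    {Z : Π q : M, TangentSpace I q}
    (hZ : MDifferentiableAt I I.tangent (fun q => (⟨q, Z q⟩ : TangentBundle I M)) p) :
    2 * G p (weylConnection I G W X Y p) (Z p) = koszul I G W X Y Z p := by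
  refine weylConnection_spec ?_ hZ
  have : FiniteDimensional ℝ (TangentSpace I p) := inferInstanceAs (FiniteDimensional ℝ E)
  have hinj : Function.Injective (G p : TangentSpace I p →ₗ[ℝ] Module.Dual ℝ (TangentSpace I p)) :=
    (injective_iff_map_eq_zero _).2 fun u hu => hnd u fun v => by rw [hu]; rfl
  have hsurj := (LinearMap.injective_iff_surjective_of_finrank_eq_finrank
    (Subspace.dual_finrank_eq (K := ℝ) (V := TangentSpace I p)).symm).1 hinj
  obtain ⟨w, hw⟩ := hsurj ((1 / 2 : ℝ) • (TensorialAt.mkHom _ p ht).toLinearMap)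
  refine ⟨w, fun Z' hZ' => ?_⟩
  have h1 := TensorialAt.mkHom_apply ht hZ'
  have h2 : G p w (Z' p) = (1 / 2 : ℝ) * TensorialAt.mkHom _ p ht (Z' p) :=
    congrArg (fun T : Module.Dual ℝ (TangentSpace I p) => T (Z' p)) hw
  rw [h2, h1]
  ring

end KoszulTensoriality

section CoordinateKoszul

variable {n : ℕ}

/-! ### The Koszul expression in coordinates -/

/-- The Sasaki-Finsler metric at `z` in the coordinates `(x, y)`. -/
noncomputable def sasakiLoc (L : Rn n × Rn n → ℝ) (z u v : Rn n × Rn n) : ℝ :=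
  ∑ a, ∑ b, gMat L z a b * (u.1 a * v.1 b)
    + ∑ a, ∑ b, gMat L z a b * ((u.2 + nonlinMap L z u.1) a * (v.2 + nonlinMap L z v.1) b)

theorem differentiableAt_sasakiLoc {L : Rn n × Rn n → ℝ} {z u v : Rn n × Rn n}
    (hL : IsRegularAt L z) : DifferentiableAt ℝ
      (fun t : (Rn n × Rn n) × (Rn n × Rn n) × (Rn n × Rn n) => sasakiLoc L t.1 t.2.1 t.2.2)
      (z, u, v) := by
  have hg : ∀ a b, DifferentiableAt ℝ
      (fun t : (Rn n × Rn n) × (Rn n × Rn n) × (Rn n × Rn n) => gMat L t.1 a b) (z, u, v) :=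
    fun a b => DifferentiableAt.comp (g := fun w => gMat L w a b) (z, u, v)
      ((contDiffAt_gMat hL.smooth a b).differentiableAt (by simp)) differentiableAt_fst
  have hN : ∀ a b, DifferentiableAt ℝ
      (fun t : (Rn n × Rn n) × (Rn n × Rn n) × (Rn n × Rn n) => nonlinCoeff L a b t.1) (z, u, v) :=
    fun a b => DifferentiableAt.comp (g := nonlinCoeff L a b) (z, u, v)
      ((contDiffAt_nonlinCoeff hL a b).differentiableAt (by simp)) differentiableAt_fst
  simp only [sasakiLoc, PiLp.add_apply, nonlinMap_apply]
  fun_prop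

/-- The coordinate field `∂/∂y^a`. -/
noncomputable def vertVec (a : Fin n) : Rn n × Rn n → Rn n × Rn n :=
  fun _ => (0, EuclideanSpace.single a 1)

/-- The coordinate field `δ/δx^a`. -/
noncomputable def horVec (L : Rn n × Rn n → ℝ) (a : Fin n) : Rn n × Rn n → Rn n × Rn n :=
  fun z => (EuclideanSpace.single a 1,
    -∑ b, nonlinCoeff L b a z • EuclideanSpace.single b 1)

theorem differentiableAt_vertVec (a : Fin n) (z : Rn n × Rn n) :
    DifferentiableAt ℝ (vertVec a) z := differentiableAt_const _

theorem fderiv_vertVec (a : Fin n) (z u : Rn n × Rn n) : fderiv ℝ (vertVec a) z u = 0 := by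
  have h : fderiv ℝ (vertVec a) z = 0 := (hasFDerivAt_const _ z).fderiv
  rw [h]
  rfl

theorem hasFDerivAt_horVec {L : Rn n × Rn n → ℝ} {z : Rn n × Rn n} (hL : IsRegularAt L z)
    (a : Fin n) : HasFDerivAt (horVec L a) ((0 : Rn n × Rn n →L[ℝ] Rn n).prod
      (-∑ b, (fderiv ℝ (nonlinCoeff L b a) z).smulRight (EuclideanSpace.single b (1 : ℝ)))) z := by
  refine (hasFDerivAt_const _ z).prodMk (HasFDerivAt.neg (HasFDerivAt.fun_sum fun b _ => ?_))
  exact ((contDiffAt_nonlinCoeff hL b a).differentiableAt (by simp)).hasFDerivAt.smul_const _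

theorem fderiv_horVec {L : Rn n × Rn n → ℝ} {z : Rn n × Rn n} (hL : IsRegularAt L z)
    (a : Fin n) (u : Rn n × Rn n) : fderiv ℝ (horVec L a) z u =
      (0, -∑ b, fderiv ℝ (nonlinCoeff L b a) z u • EuclideanSpace.single b (1 : ℝ)) := by
  rw [(hasFDerivAt_horVec hL a).fderiv]
  ext1
  · rfl
  · simp

theorem nonlinMap_single (L : Rn n × Rn n → ℝ) (z : Rn n × Rn n) (a : Fin n) :
    nonlinMap L z (EuclideanSpace.single a 1) =
      ∑ b, nonlinCoeff L b a z • EuclideanSpace.single b 1 := by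
  ext b
  simp [Finset.sum_apply, Pi.single_apply]

theorem fderiv_apply_horVec (L f : Rn n × Rn n → ℝ) (z : Rn n × Rn n) (a : Fin n) :
    fderiv ℝ f z (horVec L a z) = deltax L a f z := by
  have h : horVec L a z = (EuclideanSpace.single a 1, 0) -
      (0, nonlinMap L z (EuclideanSpace.single a 1)) := by
    rw [nonlinMap_single]
    ext1 <;> simp [horVec]
  rw [h, map_sub, clm_snd_eq_sum]
  simp [deltax, pdx, pdy]

theorem sasakiLoc_vertVec_right (L : Rn n × Rn n → ℝ) (z u : Rn n × Rn n) (d : Fin n) :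
    sasakiLoc L z u (vertVec d z) = ∑ a, (u.2 + nonlinMap L z u.1) a * gMat L z a d := by
  simp [sasakiLoc, vertVec, mul_comm]

theorem sasakiLoc_horVec_right (L : Rn n × Rn n → ℝ) (z u : Rn n × Rn n) (d : Fin n) :
    sasakiLoc L z u (horVec L d z) = ∑ a, u.1 a * gMat L z a d := by
  simp [sasakiLoc, horVec, nonlinMap_single, mul_comm, -nonlinMap_apply]

theorem sasakiLoc_vertVec_vertVec (L : Rn n × Rn n → ℝ) (z : Rn n × Rn n) (a b : Fin n) :
    sasakiLoc L z (vertVec a z) (vertVec b z) = gMat L z a b := by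
  rw [sasakiLoc_vertVec_right]
  simp [vertVec]

theorem sasakiLoc_horVec_horVec (L : Rn n × Rn n → ℝ) (z : Rn n × Rn n) (a b : Fin n) :
    sasakiLoc L z (horVec L a z) (horVec L b z) = gMat L z a b := by
  rw [sasakiLoc_horVec_right]
  simp [horVec]

theorem sasakiLoc_symm {L : Rn n × Rn n → ℝ} {z : Rn n × Rn n} (hL : ContDiffAt ℝ ∞ L z)
    (u v : Rn n × Rn n) : sasakiLoc L z u v = sasakiLoc L z v u := by
  have h : ∀ x y : Rn n, ∑ a, ∑ b, gMat L z a b * (x a * y b) =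
      ∑ a, ∑ b, gMat L z a b * (y a * x b) := by
    intro x y
    rw [Finset.sum_comm]
    refine Finset.sum_congr rfl fun a _ => Finset.sum_congr rfl fun b _ => ?_
    rw [gMat_symm hL b a]
    ring
  exact congrArg₂ (· + ·) (h _ _) (h _ _)

open Matrix in
/-- Solving `v^a g_{ad} = k_d` for `v`. -/
theorem eq_sum_inv_of_sum_gMat {L : Rn n × Rn n → ℝ} {z : Rn n × Rn n} (hL : IsRegularAt L z)
    {v k : Fin n → ℝ} (h : ∀ d, ∑ a, v a * gMat L z a d = k d) (c : Fin n) :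
    v c = ∑ d, (gMat L z)⁻¹ c d * k d := by
  have h1 : gMat L z *ᵥ v = k := by
    ext d
    rw [← h d]
    simp only [mulVec, dotProduct]
    exact Finset.sum_congr rfl fun a _ => by rw [gMat_symm hL.smooth d a, mul_comm]
  have h2 : v = (gMat L z)⁻¹ *ᵥ k := by
    rw [← h1, mulVec_mulVec, gMat_inv_mul hL, one_mulVec]
  exact congrFun h2 c

/-- The vertical derivative of `g` is totally symmetric. -/
theorem pdy_gMat_comm {L : Rn n × Rn n → ℝ} {z : Rn n × Rn n} (hL : IsRegularAt L z)
    (a b c : Fin n) :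
    pdy a (fun w => gMat L w b c) z = pdy b (fun w => gMat L w a c) z := by
  have h : ∀ i j, pdy i (fun w => gMat L w j c) z = (1 / 2) * pdy i (pdy j (pdy c L)) z := by
    intro i j
    have h1 := contDiffAt_pdy (contDiffAt_pdy hL.smooth c) j
    have h2 : fderiv ℝ (fun w => (1 / 2 : ℝ) * pdy j (pdy c L) w) z =
        (1 / 2 : ℝ) • fderiv ℝ (pdy j (pdy c L)) z :=
      fderiv_const_mul (h1.differentiableAt (by simp)) _
    exact congrArg (fun T : Rn n × Rn n →L[ℝ] ℝ => T (0, EuclideanSpace.single i 1)) h2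
  rw [h, h, pdy_pdy_comm (contDiffAt_pdy hL.smooth c)]

theorem pdy_gMat_symm {L : Rn n × Rn n → ℝ} {z : Rn n × Rn n}
    (hL : ∀ᶠ w in nhds z, IsRegularAt L w) (a b c : Fin n) :
    pdy a (fun w => gMat L w b c) z = pdy a (fun w => gMat L w c b) z := by
  unfold pdy
  rw [Filter.EventuallyEq.fderiv_eq (hL.mono fun w hw => gMat_symm hw.smooth b c)]

theorem deltax_gMat_symm {L : Rn n × Rn n → ℝ} {z : Rn n × Rn n}
    (hL : ∀ᶠ w in nhds z, IsRegularAt L w) (a b c : Fin n) :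
    deltax L a (fun w => gMat L w b c) z = deltax L a (fun w => gMat L w c b) z := by
  rw [← fderiv_apply_horVec, ← fderiv_apply_horVec,
    Filter.EventuallyEq.fderiv_eq (hL.mono fun w hw => gMat_symm hw.smooth b c)]

theorem pdy_eq_fderiv_horVec (L : Rn n × Rn n → ℝ) (z : Rn n × Rn n) (a : Fin n) :
    fderiv ℝ L z (0, (horVec L a z).1) = pdy a L z := rfl

variable {N : Type*} [TopologicalSpace N] [ChartedSpace (Rn n) N] [IsManifold (𝓡 n) ∞ N]
  {φ : OpenPartialHomeomorph N (Rn n)} {p : TangentBundle (𝓡 n) N}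

/-- The vector field on `TN` with coordinate expression `V`. -/
noncomputable abbrev coordField (φ : OpenPartialHomeomorph N (Rn n))
    (V : Rn n × Rn n → Rn n × Rn n) : Π p : TangentBundle (𝓡 n) N, TangentSpace (𝓡 n).tangent p :=
  VectorField.mpullback (𝓡 n).tangent 𝓘(ℝ, Rn n × Rn n) (tcoord φ) V

theorem tderiv_coordField (hφ : φ ∈ IsManifold.maximalAtlas (𝓡 n) ∞ N) (hp : p.1 ∈ φ.source)
    (V : Rn n × Rn n → Rn n × Rn n) : tderiv φ p (coordField φ V p) = V (tcoord φ p) :=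
  tderiv_inverse hφ hp _

theorem contMDiffAt_tcoord (hφ : φ ∈ IsManifold.maximalAtlas (𝓡 n) ∞ N) (hp : p.1 ∈ φ.source) :
    ContMDiffAt (𝓡 n).tangent 𝓘(ℝ, Rn n × Rn n) ∞ (tcoord φ) p :=
  (contMDiffOn_tcoord hφ).contMDiffAt ((tcoordHomeo hφ).open_source.mem_nhds hp)

theorem mdifferentiableAt_vectorField {V : Rn n × Rn n → Rn n × Rn n} {z : Rn n × Rn n}
    (hV : DifferentiableAt ℝ V z) :
    MDifferentiableAt 𝓘(ℝ, Rn n × Rn n) 𝓘(ℝ, Rn n × Rn n).tangent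
      (fun z => (⟨z, V z⟩ : TangentBundle 𝓘(ℝ, Rn n × Rn n) (Rn n × Rn n))) z := by
  rw [mdifferentiableAt_totalSpace]
  exact ⟨mdifferentiableAt_id, by simpa using hV.mdifferentiableAt⟩

theorem mlieBracket_vectorSpace (V W : Π z : Rn n × Rn n, TangentSpace 𝓘(ℝ, Rn n × Rn n) z) :
    VectorField.mlieBracket 𝓘(ℝ, Rn n × Rn n) V W = VectorField.lieBracket ℝ V W := by
  rw [← VectorField.mlieBracketWithin_univ, VectorField.mlieBracketWithin_eq_lieBracketWithin]
  exact VectorField.lieBracketWithin_univ (𝕜 := ℝ) (E := Rn n × Rn n)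

theorem mdifferentiableAt_coordField (hφ : φ ∈ IsManifold.maximalAtlas (𝓡 n) ∞ N)
    (hp : p.1 ∈ φ.source) {V : Rn n × Rn n → Rn n × Rn n}
    (hV : DifferentiableAt ℝ V (tcoord φ p)) :
    MDifferentiableAt (𝓡 n).tangent (𝓡 n).tangent.tangent
      (fun q => (⟨q, coordField φ V q⟩ :
        TangentBundle (𝓡 n).tangent (TangentBundle (𝓡 n) N))) p := by
  have hV' : MDifferentiableAt 𝓘(ℝ, Rn n × Rn n) 𝓘(ℝ, Rn n × Rn n).tangent
      (fun z => (⟨z, V z⟩ : TangentBundle 𝓘(ℝ, Rn n × Rn n) (Rn n × Rn n))) (tcoord φ p) :=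
    mdifferentiableAt_vectorField hV
  exact hV'.mpullback_vectorField (contMDiffAt_tcoord hφ hp) (isInvertible_tderiv hφ hp)
    two_le_infty

theorem tderiv_mlieBracket_coordField (hφ : φ ∈ IsManifold.maximalAtlas (𝓡 n) ∞ N)
    (hp : p.1 ∈ φ.source) {V W : Rn n × Rn n → Rn n × Rn n}
    (hV : DifferentiableAt ℝ V (tcoord φ p)) (hW : DifferentiableAt ℝ W (tcoord φ p)) :
    tderiv φ p (VectorField.mlieBracket (𝓡 n).tangent (coordField φ V) (coordField φ W) p) =
      fderiv ℝ W (tcoord φ p) (V (tcoord φ p)) - fderiv ℝ V (tcoord φ p) (W (tcoord φ p)) := by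
  have : IsManifold (𝓡 n).tangent (minSmoothness ℝ 2) (TangentBundle (𝓡 n) N) := by
    rw [minSmoothness_of_isRCLikeNormedField]; infer_instance
  have h := VectorField.mpullback_mlieBracket (x₀ := p) (f := tcoord φ) (I := (𝓡 n).tangent)
    (I' := 𝓘(ℝ, Rn n × Rn n)) (V := V) (W := W) (n := ∞)
    (mdifferentiableAt_vectorField hV)
    (mdifferentiableAt_vectorField hW)
    (contMDiffAt_tcoord hφ hp) (by simpa using two_le_infty)
  rw [← h]
  refine (tderiv_inverse hφ hp _).trans ?_
  exact congrFun (mlieBracket_vectorSpace V W) (tcoord φ p)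

theorem dirDeriv_coordField (hφ : φ ∈ IsManifold.maximalAtlas (𝓡 n) ∞ N) (hp : p.1 ∈ φ.source)
    (V : Rn n × Rn n → Rn n × Rn n) {f : TangentBundle (𝓡 n) N → ℝ} {f' : Rn n × Rn n → ℝ}
    (hf : f =ᶠ[nhds p] f' ∘ tcoord φ) (hf' : DifferentiableAt ℝ f' (tcoord φ p)) :
    dirDeriv (𝓡 n).tangent (coordField φ V) f p =
      fderiv ℝ f' (tcoord φ p) (V (tcoord φ p)) := by
  rw [dirDeriv_congr rfl hf]
  refine (mfderiv_comp_apply p (mdifferentiableAt_iff_differentiableAt.2 hf')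
    ((contMDiffAt_tcoord hφ hp).mdifferentiableAt (by simp)) (coordField φ V p)).trans ?_
  rw [mfderiv_eq_fderiv]
  exact congrArg _ (tderiv_coordField hφ hp V)

/-- The coordinate expression of a differentiable vector field on `TN` is differentiable. -/
theorem mdifferentiableAt_tderiv (hφ : φ ∈ IsManifold.maximalAtlas (𝓡 n) ∞ N)
    (hp : p.1 ∈ φ.source) {Z : Π q : TangentBundle (𝓡 n) N, TangentSpace (𝓡 n).tangent q}
    (hZ : MDifferentiableAt (𝓡 n).tangent (𝓡 n).tangent.tangent
      (fun q => (⟨q, Z q⟩ : TangentBundle (𝓡 n).tangent (TangentBundle (𝓡 n) N))) p) :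
    MDifferentiableAt (𝓡 n).tangent 𝓘(ℝ, Rn n × Rn n) (fun q => tderiv φ q (Z q)) p := by
  have hs : IsOpen {q : TangentBundle (𝓡 n) N | q.1 ∈ φ.source} := (tcoordHomeo hφ).open_source
  have h1 := (contMDiffOn_tcoord hφ).contMDiffOn_tangentMapWithin (m := ∞) (by simp)
    hs.uniqueMDiffOn
  have h2 : ContMDiffOn (𝓡 n).tangent.tangent 𝓘(ℝ, Rn n × Rn n).tangent ∞
      (tangentMap (𝓡 n).tangent 𝓘(ℝ, Rn n × Rn n) (tcoord φ))
      (Bundle.TotalSpace.proj ⁻¹' {q | q.1 ∈ φ.source}) := by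
    refine h1.congr fun q hq => ?_
    rw [tangentMapWithin, tangentMap, mfderivWithin_of_isOpen hs hq]
  have h3 := (contMDiff_snd_tangentBundle_modelSpace (n := ∞) (Rn n × Rn n)
    𝓘(ℝ, Rn n × Rn n)).comp_contMDiffOn h2
  have h4 := h3.contMDiffAt (x := ⟨p, Z p⟩)
    ((hs.preimage (FiberBundle.continuous_proj _ _)).mem_nhds hp)
  exact (h4.mdifferentiableAt (by simp)).comp p hZ

variable {F : TangentBundle (𝓡 n) N → ℝ}

theorem sasaki_eq_sasakiLoc (hF : IsFinsler F) (hφ : φ ∈ IsManifold.maximalAtlas (𝓡 n) ∞ N)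
    (hp : p.1 ∈ φ.source) (h0 : p.2 ≠ 0) (u v : TangentSpace (𝓡 n).tangent p) :
    sasaki F p u v = sasakiLoc (sqLoc F φ) (tcoord φ p) (tderiv φ p u) (tderiv φ p v) :=
  sasaki_apply hF hφ hp h0 u v

theorem mdifferentiableAt_sasaki (hF : IsFinsler F)
    (hφ : φ ∈ IsManifold.maximalAtlas (𝓡 n) ∞ N)
    (hp : p.1 ∈ φ.source) (h0 : p.2 ≠ 0)
    {Y Z : Π q : TangentBundle (𝓡 n) N, TangentSpace (𝓡 n).tangent q}
    (hY : MDifferentiableAt (𝓡 n).tangent (𝓡 n).tangent.tangent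
      (fun q => (⟨q, Y q⟩ : TangentBundle (𝓡 n).tangent (TangentBundle (𝓡 n) N))) p)
    (hZ : MDifferentiableAt (𝓡 n).tangent (𝓡 n).tangent.tangent
      (fun q => (⟨q, Z q⟩ : TangentBundle (𝓡 n).tangent (TangentBundle (𝓡 n) N))) p) :
    MDifferentiableAt (𝓡 n).tangent 𝓘(ℝ, ℝ) (fun q => sasaki F q (Y q) (Z q)) p := by
  have h1 : (fun q => sasaki F q (Y q) (Z q)) =ᶠ[nhds p]
      (fun t : (Rn n × Rn n) × (Rn n × Rn n) × (Rn n × Rn n) =>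
        sasakiLoc (sqLoc F φ) t.1 t.2.1 t.2.2) ∘
      (fun q => (tcoord φ q, tderiv φ q (Y q), tderiv φ q (Z q))) := by
    filter_upwards [eventually_mem_source_and_ne_zero hφ hp h0] with q hq
    exact sasaki_eq_sasakiLoc hF hφ hq.1 hq.2 _ _
  refine MDifferentiableAt.congr_of_eventuallyEq ?_ h1
  exact (mdifferentiableAt_iff_differentiableAt.2 (differentiableAt_sasakiLoc
    (isRegularAt_sqLoc hF hφ hp h0))).comp p
      (((contMDiffAt_tcoord hφ hp).mdifferentiableAt (by simp)).prodMk_space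
        ((mdifferentiableAt_tderiv hφ hp hY).prodMk_space (mdifferentiableAt_tderiv hφ hp hZ)))

/-- A vector orthogonal to the adapted frame is zero. -/
theorem sasaki_nondegenerate (hF : IsFinsler F) (hφ : φ ∈ IsManifold.maximalAtlas (𝓡 n) ∞ N)
    (hp : p.1 ∈ φ.source) (h0 : p.2 ≠ 0) {u : TangentSpace (𝓡 n).tangent p}
    (hv : ∀ d, sasaki F p u (vertField φ d p) = 0)
    (hh : ∀ d, sasaki F p u (horField F φ d p) = 0) : u = 0 := by
  have hL := isRegularAt_sqLoc hF hφ hp h0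
  have h1 : (tderiv φ p u).1 = 0 := by
    ext c
    refine (eq_sum_inv_of_sum_gMat hL (k := 0) (fun d => ?_) c).trans (by simp)
    have h := hh d
    rw [sasaki_eq_sasakiLoc hF hφ hp h0, horField] at h
    rwa [tderiv_coordField hφ hp, ← horVec, sasakiLoc_horVec_right] at h
  have h2 : (tderiv φ p u).2 = 0 := by
    ext c
    refine (eq_sum_inv_of_sum_gMat hL (k := 0) (fun d => ?_) c).trans (by simp)
    have h := hv d
    rw [sasaki_eq_sasakiLoc hF hφ hp h0, vertField] at h
    rwa [tderiv_coordField hφ hp, ← vertVec, sasakiLoc_vertVec_right, h1, map_zero,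
      add_zero] at h
  refine tderiv_injective hφ hp ?_
  rw [map_zero]
  exact Prod.ext h1 h2

/-- The Koszul expression at `z` of fields given in the coordinates `(x, y)`. -/
noncomputable def koszulLoc (L : Rn n × Rn n → ℝ) (U V W : Rn n × Rn n → Rn n × Rn n)
    (z : Rn n × Rn n) : ℝ :=
  fderiv ℝ (fun w => sasakiLoc L w (V w) (W w)) z (U z)
    + fderiv ℝ (fun w => sasakiLoc L w (W w) (U w)) z (V z)
    - fderiv ℝ (fun w => sasakiLoc L w (U w) (V w)) z (W z)
    + sasakiLoc L z (fderiv ℝ V z (U z) - fderiv ℝ U z (V z)) (W z)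
    - sasakiLoc L z (fderiv ℝ W z (V z) - fderiv ℝ V z (W z)) (U z)
    + sasakiLoc L z (fderiv ℝ U z (W z) - fderiv ℝ W z (U z)) (V z)
    + (1 / 2) * fderiv ℝ L z (0, (U z).1) * sasakiLoc L z (V z) (W z)
    + (1 / 2) * fderiv ℝ L z (0, (V z).1) * sasakiLoc L z (W z) (U z)
    - (1 / 2) * fderiv ℝ L z (0, (W z).1) * sasakiLoc L z (U z) (V z)

theorem differentiableAt_sasakiLoc_fields {L : Rn n × Rn n → ℝ} {z : Rn n × Rn n}
    (hL : IsRegularAt L z) {A B : Rn n × Rn n → Rn n × Rn n} (hA : DifferentiableAt ℝ A z)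
    (hB : DifferentiableAt ℝ B z) : DifferentiableAt ℝ (fun w => sasakiLoc L w (A w) (B w)) z := by
  have h1 : DifferentiableAt ℝ (fun w => (w, A w, B w)) z :=
    differentiableAt_id.prodMk (hA.prodMk hB)
  have h2 := (differentiableAt_sasakiLoc (u := A z) (v := B z) hL).hasFDerivAt
  exact (HasFDerivAt.comp (f := fun w => (w, A w, B w)) z h2 h1.hasFDerivAt).differentiableAt

/-- Since the metric, the Cartan form, derivatives and brackets are all natural under `tcoord φ`,
the Koszul expression can be evaluated in coordinates. -/
theorem koszul_coordField (hF : IsFinsler F) (hφ : φ ∈ IsManifold.maximalAtlas (𝓡 n) ∞ N)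
    (hp : p.1 ∈ φ.source) (h0 : p.2 ≠ 0) {U V W : Rn n × Rn n → Rn n × Rn n}
    (hU : DifferentiableAt ℝ U (tcoord φ p)) (hV : DifferentiableAt ℝ V (tcoord φ p))
    (hW : DifferentiableAt ℝ W (tcoord φ p)) :
    koszul (𝓡 n).tangent (sasaki F) (cartanForm F) (coordField φ U) (coordField φ V)
        (coordField φ W) p = koszulLoc (sqLoc F φ) U V W (tcoord φ p) := by
  have hS : ∀ A B : Rn n × Rn n → Rn n × Rn n,
      (fun q => sasaki F q (coordField φ A q) (coordField φ B q)) =ᶠ[nhds p]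
        (fun w => sasakiLoc (sqLoc F φ) w (A w) (B w)) ∘ tcoord φ := by
    intro A B
    filter_upwards [eventually_mem_source_and_ne_zero hφ hp h0] with q hq
    rw [sasaki_eq_sasakiLoc hF hφ hq.1 hq.2, tderiv_coordField hφ hq.1, tderiv_coordField hφ hq.1]
    rfl
  have hL := isRegularAt_sqLoc hF hφ hp h0
  have d1 := dirDeriv_coordField hφ hp U (hS V W) (differentiableAt_sasakiLoc_fields hL hV hW)
  have d2 := dirDeriv_coordField hφ hp V (hS W U) (differentiableAt_sasakiLoc_fields hL hW hU)
  have d3 := dirDeriv_coordField hφ hp W (hS U V) (differentiableAt_sasakiLoc_fields hL hU hV)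
  unfold koszul
  rw [d1, d2, d3]
  simp only [sasaki_eq_sasakiLoc hF hφ hp h0, cartanForm_apply hF hφ hp h0,
    tderiv_mlieBracket_coordField hφ hp hU hV, tderiv_mlieBracket_coordField hφ hp hV hW,
    tderiv_mlieBracket_coordField hφ hp hW hU, tderiv_coordField hφ hp]
  rfl

/-- The Weyl connection of coordinate fields solves the generalized Koszul formula. -/
theorem weylConnection_coordField (hF : IsFinsler F)
    (hφ : φ ∈ IsManifold.maximalAtlas (𝓡 n) ∞ N)
    (hp : p.1 ∈ φ.source) (h0 : p.2 ≠ 0) {U V W : Rn n × Rn n → Rn n × Rn n}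
    (hU : DifferentiableAt ℝ U (tcoord φ p)) (hV : DifferentiableAt ℝ V (tcoord φ p))
    (hW : DifferentiableAt ℝ W (tcoord φ p)) :
    2 * sasaki F p (weylConnection (𝓡 n).tangent (sasaki F) (cartanForm F)
      (coordField φ U) (coordField φ V) p) (coordField φ W p) =
    koszul (𝓡 n).tangent (sasaki F) (cartanForm F) (coordField φ U) (coordField φ V)
        (coordField φ W) p := by
  refine weylConnection_koszul (fun u hu => sasaki_nondegenerate hF hφ hp h0
    (fun d => hu _) (fun d => hu _)) (koszul_tensorialAt (fun u v => ?_) (fun Z hZ => ?_)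
      fun Z hZ => ?_) (mdifferentiableAt_coordField hφ hp hW)
  · rw [sasaki_eq_sasakiLoc hF hφ hp h0, sasaki_eq_sasakiLoc hF hφ hp h0,
      sasakiLoc_symm (isRegularAt_sqLoc hF hφ hp h0).smooth]
  · exact mdifferentiableAt_sasaki hF hφ hp h0 (mdifferentiableAt_coordField hφ hp hV) hZ
  · exact mdifferentiableAt_sasaki hF hφ hp h0 hZ (mdifferentiableAt_coordField hφ hp hU)

end CoordinateKoszul

section Vranceanu

variable {n : ℕ}

/-! ### The Koszul expression of the adapted frame -/

theorem sasakiLoc_vert_horVec (L : Rn n × Rn n → ℝ) (z : Rn n × Rn n) {u : Rn n × Rn n}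
    (hu : u.1 = 0) (d : Fin n) : sasakiLoc L z u (horVec L d z) = 0 := by
  rw [sasakiLoc_horVec_right, hu]
  simp

theorem sasakiLoc_zero_left (L : Rn n × Rn n → ℝ) (z v : Rn n × Rn n) :
    sasakiLoc L z 0 v = 0 := by
  simp [sasakiLoc]

/-- By total symmetry of `∂g_{ab}/∂y^c`, two of the three derivative terms cancel. -/
theorem koszulLoc_vertVec {L : Rn n × Rn n → ℝ} {z : Rn n × Rn n}
    (hL : ∀ᶠ w in nhds z, IsRegularAt L w) (a b d : Fin n) :
    koszulLoc L (vertVec b) (vertVec a) (vertVec d) z = pdy d (fun w => gMat L w a b) z := by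
  have h1 : ∀ i j k, fderiv ℝ (fun w => gMat L w i j) z (vertVec k z) =
      pdy k (fun w => gMat L w i j) z := fun _ _ _ => rfl
  have h2 : ∀ k, (vertVec k z).1 = (0 : Rn n) := fun _ => rfl
  simp only [koszulLoc, sasakiLoc_vertVec_vertVec, fderiv_vertVec, sub_self, sasakiLoc_zero_left,
    h1, h2, Prod.mk_zero_zero, map_zero, mul_zero, zero_mul, add_zero, sub_zero]
  rw [pdy_gMat_symm hL b a d, pdy_gMat_comm hL.self_of_nhds b d a,
    pdy_gMat_comm hL.self_of_nhds a d b]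
  ring

/-- The bracket terms vanish because brackets of horizontal coordinate fields are vertical. -/
theorem koszulLoc_horVec {L : Rn n × Rn n → ℝ} {z : Rn n × Rn n}
    (hL : IsRegularAt L z) (a b d : Fin n) :
    koszulLoc L (horVec L b) (horVec L a) (horVec L d) z =
      deltax L b (fun w => gMat L w a d) z + deltax L a (fun w => gMat L w d b) z
        - deltax L d (fun w => gMat L w b a) z
        + (1 / 2) * pdy b L z * gMat L z a d + (1 / 2) * pdy a L z * gMat L z d b
        - (1 / 2) * pdy d L z * gMat L z b a := by
  have h : ∀ i u j v k, sasakiLoc L z (fderiv ℝ (horVec L i) z u - fderiv ℝ (horVec L j) z v)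
      (horVec L k z) = 0 := by
    intro i u j v k
    refine sasakiLoc_vert_horVec L z ?_ k
    rw [fderiv_horVec hL, fderiv_horVec hL]
    simp
  simp only [koszulLoc, sasakiLoc_horVec_horVec, fderiv_apply_horVec, h, pdy_eq_fderiv_horVec]
  ring

variable {N : Type*} [TopologicalSpace N] [ChartedSpace (Rn n) N] [IsManifold (𝓡 n) ∞ N]
  {φ : OpenPartialHomeomorph N (Rn n)} {p : TangentBundle (𝓡 n) N}
  {F : TangentBundle (𝓡 n) N → ℝ}

/-! ### The adapted frame -/

theorem vertField_eq_coordField (φ : OpenPartialHomeomorph N (Rn n)) (a : Fin n) :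
    vertField φ a = coordField φ (vertVec a) := rfl

theorem horField_eq_coordField (F : TangentBundle (𝓡 n) N → ℝ)
    (φ : OpenPartialHomeomorph N (Rn n)) (a : Fin n) :
    horField F φ a = coordField φ (horVec (sqLoc F φ) a) := rfl

theorem vertProj_vertField (hF : IsFinsler F) (hφ : φ ∈ IsManifold.maximalAtlas (𝓡 n) ∞ N)
    (hp : p.1 ∈ φ.source) (h0 : p.2 ≠ 0) (a : Fin n) :
    vertProj F p (vertField φ a p) = vertField φ a p := by
  refine tderiv_injective hφ hp ?_
  rw [tderiv_vertProj hF hφ hp h0, vertComp, tderiv_vertField hφ hp]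
  simp

theorem horProj_vertField (hF : IsFinsler F) (hφ : φ ∈ IsManifold.maximalAtlas (𝓡 n) ∞ N)
    (hp : p.1 ∈ φ.source) (h0 : p.2 ≠ 0) (a : Fin n) :
    horProj F p (vertField φ a p) = 0 := by
  refine tderiv_injective hφ hp ?_
  rw [tderiv_horProj hF hφ hp h0, tderiv_vertField hφ hp, map_zero]
  simp

theorem vertProj_horField (hF : IsFinsler F) (hφ : φ ∈ IsManifold.maximalAtlas (𝓡 n) ∞ N)
    (hp : p.1 ∈ φ.source) (h0 : p.2 ≠ 0) (a : Fin n) :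
    vertProj F p (horField F φ a p) = 0 := by
  refine tderiv_injective hφ hp ?_
  rw [tderiv_vertProj hF hφ hp h0, vertComp, tderiv_horField F hφ hp, map_zero]
  simp

theorem horProj_horField (hF : IsFinsler F) (hφ : φ ∈ IsManifold.maximalAtlas (𝓡 n) ∞ N)
    (hp : p.1 ∈ φ.source) (h0 : p.2 ≠ 0) (a : Fin n) :
    horProj F p (horField F φ a p) = horField F φ a p := by
  refine tderiv_injective hφ hp ?_
  rw [tderiv_horProj hF hφ hp h0, tderiv_horField F hφ hp]

theorem tderiv_sum_vertField (hφ : φ ∈ IsManifold.maximalAtlas (𝓡 n) ∞ N)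
    (hp : p.1 ∈ φ.source) (v : Rn n) :
    tderiv φ p (∑ c, v c • vertField φ c p) = (0, v) := by
  simp only [map_sum, map_smul, tderiv_vertField hφ hp]
  ext1
  · simp [Prod.fst_sum]
  · simp only [Prod.snd_sum, Prod.smul_snd, sum_smul_single]

theorem tderiv_sum_horField (hφ : φ ∈ IsManifold.maximalAtlas (𝓡 n) ∞ N)
    (hp : p.1 ∈ φ.source) (v : Rn n) :
    tderiv φ p (∑ c, v c • horField F φ c p) = (v, -nonlinMap (sqLoc F φ) (tcoord φ p) v) := by
  simp only [map_sum, map_smul, tderiv_horField F hφ hp]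
  ext1
  · simp only [Prod.fst_sum, Prod.smul_fst, sum_smul_single]
  · simp only [Prod.snd_sum, Prod.smul_snd, smul_neg, Finset.sum_neg_distrib, ← map_smul,
      ← map_sum, sum_smul_single]

theorem linearIndependent_adaptedFrame (hφ : φ ∈ IsManifold.maximalAtlas (𝓡 n) ∞ N)
    (hp : p.1 ∈ φ.source) : LinearIndependent ℝ
      (Sum.elim (fun a => horField F φ a p) (fun a => vertField φ a p)) := by
  rw [Fintype.linearIndependent_iff]
  intro g hg
  rw [Fintype.sum_sum_type] at hg
  simp only [Sum.elim_inl, Sum.elim_inr] at hg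
  have h1 := congrArg (tderiv φ p) hg
  rw [map_add, map_zero] at h1
  have e1 := tderiv_sum_horField (F := F) hφ hp (WithLp.toLp 2 fun a => g (Sum.inl a))
  have e2 := tderiv_sum_vertField hφ hp (WithLp.toLp 2 fun a => g (Sum.inr a))
  dsimp only at e1 e2
  rw [e1, e2] at h1
  have h2 : (WithLp.toLp 2 fun a => g (Sum.inl a) : Rn n) = 0 := by
    simpa using congrArg Prod.fst h1
  have h3 : (WithLp.toLp 2 fun a => g (Sum.inr a) : Rn n) = 0 := by
    simpa [h2] using congrArg Prod.snd h1
  rintro (a | a)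
  · exact congrArg (fun v : Rn n => v a) h2
  · exact congrArg (fun v : Rn n => v a) h3

/-! ### The Vranceanu connection on the adapted frame -/

/-- The Vranceanu connection at `p` depends only on the germs at `p` of the projected fields. -/
theorem vranceanuCartan_congr {X Y XV XH YV YH : Π q : TangentBundle (𝓡 n) N,
      TangentSpace (𝓡 n).tangent q}
    (hXV : ∀ᶠ q in nhds p, vertProj F q (X q) = XV q)
    (hXH : ∀ᶠ q in nhds p, horProj F q (X q) = XH q)
    (hYV : ∀ᶠ q in nhds p, vertProj F q (Y q) = YV q)
    (hYH : ∀ᶠ q in nhds p, horProj F q (Y q) = YH q) :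
    vranceanuCartan F X Y p =
      vertProj F p (weylConnection (𝓡 n).tangent (sasaki F) (cartanForm F) XV YV p)
      + horProj F p (weylConnection (𝓡 n).tangent (sasaki F) (cartanForm F) XH YH p)
      + vertProj F p (VectorField.mlieBracket (𝓡 n).tangent XH YV p)
      + horProj F p (VectorField.mlieBracket (𝓡 n).tangent XV YH p) := by
  unfold vranceanuCartan vranceanu
  rw [weylConnection_congr hXV hYV, weylConnection_congr hXH hYH,
    Filter.EventuallyEq.mlieBracket_vectorField_eq hXH hYV,
    Filter.EventuallyEq.mlieBracket_vectorField_eq hXV hYH]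

/-- If the Koszul expression vanishes for every test field, the Weyl connection is zero, since `0`
satisfies the defining property and `sasaki` is nondegenerate. -/
theorem weylConnection_eq_zero (hF : IsFinsler F) (hφ : φ ∈ IsManifold.maximalAtlas (𝓡 n) ∞ N)
    (hp : p.1 ∈ φ.source) (h0 : p.2 ≠ 0)
    {X Y : Π q : TangentBundle (𝓡 n) N, TangentSpace (𝓡 n).tangent q}
    (h : ∀ Z, koszul (𝓡 n).tangent (sasaki F) (cartanForm F) X Y Z p = 0) :
    weylConnection (𝓡 n).tangent (sasaki F) (cartanForm F) X Y p = 0 := by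
  have hspec := @weylConnection_spec _ _ _ _ _ (𝓡 n).tangent (TangentBundle (𝓡 n) N) _ _
    (sasaki F) (cartanForm F) _ X Y p ⟨0, fun Z _ => by rw [h Z]; simp⟩
  refine sasaki_nondegenerate hF hφ hp h0 (fun d => ?_) fun d => ?_
  · have h1 := hspec (mdifferentiableAt_coordField hφ hp (differentiableAt_vertVec d _))
    rw [h] at h1
    rw [vertField_eq_coordField]
    linarith
  · have h1 := hspec (mdifferentiableAt_coordField hφ hp
      (hasFDerivAt_horVec (isRegularAt_sqLoc hF hφ hp h0) d).differentiableAt)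
    rw [h] at h1
    rw [horField_eq_coordField]
    linarith

theorem weylConnection_zero_left (hF : IsFinsler F)
    (hφ : φ ∈ IsManifold.maximalAtlas (𝓡 n) ∞ N) (hp : p.1 ∈ φ.source) (h0 : p.2 ≠ 0)
    (Y : Π q : TangentBundle (𝓡 n) N, TangentSpace (𝓡 n).tangent q) :
    weylConnection (𝓡 n).tangent (sasaki F) (cartanForm F) 0 Y p = 0 :=
  weylConnection_eq_zero hF hφ hp h0 fun Z => koszul_zero_left Y Z p

theorem weylConnection_zero_right (hF : IsFinsler F)
    (hφ : φ ∈ IsManifold.maximalAtlas (𝓡 n) ∞ N) (hp : p.1 ∈ φ.source) (h0 : p.2 ≠ 0)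
    (X : Π q : TangentBundle (𝓡 n) N, TangentSpace (𝓡 n).tangent q) :
    weylConnection (𝓡 n).tangent (sasaki F) (cartanForm F) X 0 p = 0 :=
  weylConnection_eq_zero hF hφ hp h0 fun Z => koszul_zero_middle X Z p

theorem vranceanuCartan_vert_vert (hF : IsFinsler F)
    (hφ : φ ∈ IsManifold.maximalAtlas (𝓡 n) ∞ N) (hp : p.1 ∈ φ.source) (h0 : p.2 ≠ 0)
    (a b : Fin n) : vranceanuCartan F (vertField φ b) (vertField φ a) p =
      ∑ c, ((1 / 2) * ∑ d, (gMat (sqLoc F φ) (tcoord φ p))⁻¹ c d *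
        pdy d (fun w => gMat (sqLoc F φ) w a b) (tcoord φ p)) • vertField φ c p := by
  have hgood := eventually_mem_source_and_ne_zero hφ hp h0
  have hL := eventually_isRegularAt_sqLoc hF hφ hp h0
  have hV : ∀ i, ∀ᶠ q in nhds p, vertProj F q (vertField φ i q) = vertField φ i q := fun i =>
    hgood.mono fun q hq => vertProj_vertField hF hφ hq.1 hq.2 i
  have hH : ∀ i, ∀ᶠ q in nhds p, horProj F q (vertField φ i q) =
      (0 : Π q : TangentBundle (𝓡 n) N, TangentSpace (𝓡 n).tangent q) q := fun i =>
    hgood.mono fun q hq => horProj_vertField hF hφ hq.1 hq.2 i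
  rw [vranceanuCartan_congr (hV b) (hH b) (hV a) (hH a), weylConnection_zero_left hF hφ hp h0,
    VectorField.mlieBracket_zero_left, VectorField.mlieBracket_zero_right, Pi.zero_apply,
    map_zero, map_zero, add_zero, add_zero, add_zero]
  refine tderiv_injective hφ hp ?_
  have e := tderiv_sum_vertField hφ hp (WithLp.toLp 2 fun c => (1 / 2) *
    ∑ d, (gMat (sqLoc F φ) (tcoord φ p))⁻¹ c d *
        pdy d (fun w => gMat (sqLoc F φ) w a b) (tcoord φ p))
  dsimp only at e
  rw [e, tderiv_vertProj hF hφ hp h0]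
  refine Prod.ext rfl ?_
  ext c
  refine (eq_sum_inv_of_sum_gMat hL.self_of_nhds
    (k := fun d => (1 / 2) * pdy d (fun w => gMat (sqLoc F φ) w a b) (tcoord φ p))
    (fun d => ?_) c).trans ?_
  · have h1 := weylConnection_coordField hF hφ hp h0 (differentiableAt_vertVec b _)
      (differentiableAt_vertVec a _) (differentiableAt_vertVec d _)
    rw [koszul_coordField hF hφ hp h0 (differentiableAt_vertVec b _)
      (differentiableAt_vertVec a _) (differentiableAt_vertVec d _), koszulLoc_vertVec hL,
      sasaki_eq_sasakiLoc hF hφ hp h0, tderiv_coordField hφ hp (vertVec d),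
      sasakiLoc_vertVec_right] at h1
    rw [← h1, ← mul_assoc]
    norm_num
    rfl
  · dsimp only
    rw [Finset.mul_sum]
    exact Finset.sum_congr rfl fun d _ => by ring

theorem vranceanuCartan_hor_vert (hF : IsFinsler F)
    (hφ : φ ∈ IsManifold.maximalAtlas (𝓡 n) ∞ N) (hp : p.1 ∈ φ.source) (h0 : p.2 ≠ 0)
    (a b : Fin n) : vranceanuCartan F (horField F φ b) (vertField φ a) p =
      ∑ c, pdy a (pdy b (sprayCoeff (sqLoc F φ) c)) (tcoord φ p) • vertField φ c p := by
  have hgood := eventually_mem_source_and_ne_zero hφ hp h0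
  have hL := isRegularAt_sqLoc hF hφ hp h0
  have hXV : ∀ᶠ q in nhds p, vertProj F q (horField F φ b q) =
      (0 : Π q : TangentBundle (𝓡 n) N, TangentSpace (𝓡 n).tangent q) q :=
    hgood.mono fun q hq => vertProj_horField hF hφ hq.1 hq.2 b
  have hXH : ∀ᶠ q in nhds p, horProj F q (horField F φ b q) = horField F φ b q :=
    hgood.mono fun q hq => horProj_horField hF hφ hq.1 hq.2 b
  have hYV : ∀ᶠ q in nhds p, vertProj F q (vertField φ a q) = vertField φ a q :=
    hgood.mono fun q hq => vertProj_vertField hF hφ hq.1 hq.2 a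
  have hYH : ∀ᶠ q in nhds p, horProj F q (vertField φ a q) =
      (0 : Π q : TangentBundle (𝓡 n) N, TangentSpace (𝓡 n).tangent q) q :=
    hgood.mono fun q hq => horProj_vertField hF hφ hq.1 hq.2 a
  rw [vranceanuCartan_congr hXV hXH hYV hYH, weylConnection_zero_left hF hφ hp h0,
    weylConnection_zero_right hF hφ hp h0,
    VectorField.mlieBracket_zero_left, Pi.zero_apply,
    map_zero, map_zero, add_zero, add_zero, zero_add]
  refine tderiv_injective hφ hp ?_
  -- `[δ/δx^b, ∂/∂y^a] = ∂G^c_b/∂y^a ∂/∂y^c`.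
  have hbr : tderiv φ p (VectorField.mlieBracket (𝓡 n).tangent (horField F φ b)
      (vertField φ a) p) =
        (0, ∑ c, pdy a (pdy b (sprayCoeff (sqLoc F φ) c)) (tcoord φ p) •
          EuclideanSpace.single c (1 : ℝ)) := by
    refine (tderiv_mlieBracket_coordField hφ hp (hasFDerivAt_horVec hL b).differentiableAt
      (differentiableAt_vertVec a _)).trans ?_
    rw [fderiv_vertVec, fderiv_horVec hL]
    ext1
    · simp
    · rw [zero_sub, Prod.snd_neg, neg_neg]
      rfl
  have e := tderiv_sum_vertField hφ hp (WithLp.toLp 2 fun c =>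
    pdy a (pdy b (sprayCoeff (sqLoc F φ) c)) (tcoord φ p))
  dsimp only at e
  rw [e, tderiv_vertProj hF hφ hp h0, vertComp, hbr]
  refine Prod.ext rfl ?_
  rw [map_zero, add_zero]
  exact sum_smul_single (WithLp.toLp 2 fun c =>
    pdy a (pdy b (sprayCoeff (sqLoc F φ) c)) (tcoord φ p))

theorem vranceanuCartan_vert_hor (hF : IsFinsler F)
    (hφ : φ ∈ IsManifold.maximalAtlas (𝓡 n) ∞ N) (hp : p.1 ∈ φ.source) (h0 : p.2 ≠ 0)
    (a b : Fin n) : vranceanuCartan F (vertField φ b) (horField F φ a) p = 0 := by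
  have hgood := eventually_mem_source_and_ne_zero hφ hp h0
  have hL := isRegularAt_sqLoc hF hφ hp h0
  have hXV : ∀ᶠ q in nhds p, vertProj F q (vertField φ b q) = vertField φ b q :=
    hgood.mono fun q hq => vertProj_vertField hF hφ hq.1 hq.2 b
  have hXH : ∀ᶠ q in nhds p, horProj F q (vertField φ b q) =
      (0 : Π q : TangentBundle (𝓡 n) N, TangentSpace (𝓡 n).tangent q) q :=
    hgood.mono fun q hq => horProj_vertField hF hφ hq.1 hq.2 b
  have hYV : ∀ᶠ q in nhds p, vertProj F q (horField F φ a q) =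
      (0 : Π q : TangentBundle (𝓡 n) N, TangentSpace (𝓡 n).tangent q) q :=
    hgood.mono fun q hq => vertProj_horField hF hφ hq.1 hq.2 a
  have hYH : ∀ᶠ q in nhds p, horProj F q (horField F φ a q) = horField F φ a q :=
    hgood.mono fun q hq => horProj_horField hF hφ hq.1 hq.2 a
  rw [vranceanuCartan_congr hXV hXH hYV hYH, weylConnection_zero_left hF hφ hp h0,
    weylConnection_zero_right hF hφ hp h0,
    VectorField.mlieBracket_zero_left, Pi.zero_apply,
    map_zero, map_zero, add_zero, add_zero, zero_add]
  -- The bracket `[∂/∂y^b, δ/δx^a]` is vertical.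
  refine tderiv_injective hφ hp ?_
  have hbr : (tderiv φ p (VectorField.mlieBracket (𝓡 n).tangent (vertField φ b)
      (horField F φ a) p)).1 = 0 := by
    refine (congrArg Prod.fst (tderiv_mlieBracket_coordField hφ hp
      (differentiableAt_vertVec b _) (hasFDerivAt_horVec hL a).differentiableAt)).trans ?_
    rw [fderiv_vertVec, fderiv_horVec hL]
    simp
  rw [tderiv_horProj hF hφ hp h0, hbr, map_zero, map_zero, neg_zero]
  rfl

theorem vranceanuCartan_hor_hor (hF : IsFinsler F)
    (hφ : φ ∈ IsManifold.maximalAtlas (𝓡 n) ∞ N) (hp : p.1 ∈ φ.source) (h0 : p.2 ≠ 0)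
    (a b : Fin n) : vranceanuCartan F (horField F φ b) (horField F φ a) p =
      ∑ c, (∑ d, (gMat (sqLoc F φ) (tcoord φ p))⁻¹ c d * ((1 / 2) *
        koszulLoc (sqLoc F φ) (horVec (sqLoc F φ) b) (horVec (sqLoc F φ) a)
          (horVec (sqLoc F φ) d) (tcoord φ p))) • horField F φ c p := by
  have hgood := eventually_mem_source_and_ne_zero hφ hp h0
  have hL := isRegularAt_sqLoc hF hφ hp h0
  have hV : ∀ i, ∀ᶠ q in nhds p, vertProj F q (horField F φ i q) =
      (0 : Π q : TangentBundle (𝓡 n) N, TangentSpace (𝓡 n).tangent q) q := fun i =>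
    hgood.mono fun q hq => vertProj_horField hF hφ hq.1 hq.2 i
  have hH : ∀ i, ∀ᶠ q in nhds p, horProj F q (horField F φ i q) = horField F φ i q := fun i =>
    hgood.mono fun q hq => horProj_horField hF hφ hq.1 hq.2 i
  have hd : ∀ i, DifferentiableAt ℝ (horVec (sqLoc F φ) i) (tcoord φ p) := fun i =>
    (hasFDerivAt_horVec hL i).differentiableAt
  rw [vranceanuCartan_congr (hV b) (hH b) (hV a) (hH a), weylConnection_zero_left hF hφ hp h0,
    VectorField.mlieBracket_zero_left, VectorField.mlieBracket_zero_right, Pi.zero_apply,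
    map_zero, map_zero, add_zero, add_zero, zero_add]
  refine tderiv_injective hφ hp ?_
  have e := tderiv_sum_horField (F := F) hφ hp (WithLp.toLp 2 fun c =>
    ∑ d, (gMat (sqLoc F φ) (tcoord φ p))⁻¹ c d * ((1 / 2) *
        koszulLoc (sqLoc F φ) (horVec (sqLoc F φ) b) (horVec (sqLoc F φ) a)
          (horVec (sqLoc F φ) d) (tcoord φ p)))
  dsimp only at e
  have key : (tderiv φ p (weylConnection (𝓡 n).tangent (sasaki F) (cartanForm F)
      (horField F φ b) (horField F φ a) p)).1 = (WithLp.toLp 2 fun c =>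
    ∑ d, (gMat (sqLoc F φ) (tcoord φ p))⁻¹ c d * ((1 / 2) *
        koszulLoc (sqLoc F φ) (horVec (sqLoc F φ) b) (horVec (sqLoc F φ) a)
          (horVec (sqLoc F φ) d) (tcoord φ p))) := by
    ext c
    refine eq_sum_inv_of_sum_gMat hL (fun d => ?_) c
    have h1 := weylConnection_coordField hF hφ hp h0 (hd b) (hd a) (hd d)
    rw [koszul_coordField hF hφ hp h0 (hd b) (hd a) (hd d),
      sasaki_eq_sasakiLoc hF hφ hp h0, tderiv_coordField hφ hp (horVec (sqLoc F φ) d),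
      sasakiLoc_horVec_right] at h1
    rw [← h1, ← mul_assoc]
    norm_num
    rfl
  rw [e, tderiv_horProj hF hφ hp h0, key]

end Vranceanu

end WeylVranceanu

theorem proposition3p5 {n : ℕ} {N : Type*} [TopologicalSpace N]
    [ChartedSpace (EuclideanSpace ℝ (Fin n)) N] [IsManifold (𝓡 n) ∞ N]
    (F : TangentBundle (𝓡 n) N → ℝ) (hF : IsFinsler F)
    (φ : OpenPartialHomeomorph N (EuclideanSpace ℝ (Fin n)))
    (hφ : φ ∈ IsManifold.maximalAtlas (𝓡 n) ∞ N)
    (p : TangentBundle (𝓡 n) N) (hpφ : p.1 ∈ φ.source) (hp : p.2 ≠ 0) :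
    let L := sqLoc F φ
    let z := tcoord φ p
    let g := gMat L
    let C : Fin n → Fin n → Fin n → ℝ := fun c a b =>
      (1 / 2) * ∑ d, (g z)⁻¹ c d * pdy d (fun w => g w a b) z
    let D : Fin n → Fin n → Fin n → ℝ := fun c a b => pdy a (pdy b (sprayCoeff L c)) z
    let Fc : Fin n → Fin n → Fin n → ℝ := fun c a b =>
      (1 / 4) * (2 * ∑ d, (g z)⁻¹ c d *
            (deltax L a (fun w => g w d b) z + deltax L b (fun w => g w a d) z
              - deltax L d (fun w => g w a b) z)
          + pdy a L z * (if b = c then 1 else 0)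
          + pdy b L z * (if a = c then 1 else 0)
          - (∑ u, pdy u L z * (g z)⁻¹ u c) * g z a b)
    LinearIndependent ℝ
        (Sum.elim (fun a => horField F φ a p) (fun a => vertField φ a p)) ∧
      (∀ a b, vranceanuCartan F (vertField φ b) (vertField φ a) p
        = ∑ c, C c a b • vertField φ c p) ∧
      (∀ a b, vranceanuCartan F (horField F φ b) (vertField φ a) p
        = ∑ c, D c a b • vertField φ c p) ∧
      (∀ a b, vranceanuCartan F (vertField φ b) (horField F φ a) p = 0) ∧
      (∀ a b, vranceanuCartan F (horField F φ b) (horField F φ a) p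
        = ∑ c, Fc c a b • horField F φ c p) ∧
      (∀ a b c, Fc c a b = horChristoffel L c a b z
        + (1 / 2) * ∑ u, z.2 u *
            (g z u b * (if a = c then 1 else 0) + g z a u * (if b = c then 1 else 0)
              - g z a b * (if u = c then 1 else 0))) := by
  intro L z g C D Fc
  have hL : IsRegularAt L z := isRegularAt_sqLoc hF hφ hpφ hp
  have hLev : ∀ᶠ w in nhds z, IsRegularAt L w := eventually_isRegularAt_sqLoc hF hφ hpφ hp
  have hsymm : ∀ a b, g z a b = g z b a := gMat_symm hL.smooth
  have hdet : IsUnit (g z).det := (Matrix.isUnit_iff_isUnit_det _).1 hL.posDef.isUnit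
  have hinvsymm : ∀ a b, (g z)⁻¹ a b = (g z)⁻¹ b a := by
    intro a b
    have h : (g z).transpose = g z := by
      ext i j
      exact hsymm j i
    have h2 := congrFun (congrFun (Matrix.transpose_nonsing_inv (g z)) b) a
    rwa [h, Matrix.transpose_apply] at h2
  have hinv : ∀ c a, ∑ d, (g z)⁻¹ c d * g z d a = if a = c then 1 else 0 := by
    intro c a
    have h := congrFun (congrFun (gMat_inv_mul hL) c) a
    rw [Matrix.mul_apply, Matrix.one_apply] at h
    rw [h]
    simp only [eq_comm]
  have hEuler : ∀ a, pdy a L z = 2 * ∑ u, g z a u * z.2 u :=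
    pdy_eq_of_homogeneous hL.smooth (sqLoc_homogeneous hF φ)
  refine ⟨linearIndependent_adaptedFrame hφ hpφ, vranceanuCartan_vert_vert hF hφ hpφ hp,
    vranceanuCartan_hor_vert hF hφ hpφ hp, vranceanuCartan_vert_hor hF hφ hpφ hp, ?_, ?_⟩
  · intro a b
    rw [vranceanuCartan_hor_hor hF hφ hpφ hp]
    refine Finset.sum_congr rfl fun c _ => congrArg (fun t : ℝ => t • horField F φ c p) ?_
    change ∑ d, (g z)⁻¹ c d * ((1 / 2) * koszulLoc L (horVec L b) (horVec L a) (horVec L d) z) = _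
    -- Write `δ^c_b = g^{cd} g_{db}`, so that both sides become sums of `g^{cd}` times a
    -- term in `d`.
    have e1 : (if b = c then (1 : ℝ) else 0) = ∑ d, (g z)⁻¹ c d * g z d b := (hinv c b).symm
    have e2 : (if a = c then (1 : ℝ) else 0) = ∑ d, (g z)⁻¹ c d * g z d a := (hinv c a).symm
    simp only [Fc, e1, e2]
    rw [Finset.mul_sum, Finset.mul_sum, Finset.mul_sum, Finset.sum_mul, ← Finset.sum_add_distrib,
      ← Finset.sum_add_distrib, ← Finset.sum_sub_distrib, Finset.mul_sum]
    refine Finset.sum_congr rfl fun d _ => ?_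
    rw [koszulLoc_horVec hL, deltax_gMat_symm hLev d b a, hinvsymm d c]
    change _ * ((1 / 2) * (_ + _ - _ + (1 / 2) * pdy b L z * g z a d
      + (1 / 2) * pdy a L z * g z d b - (1 / 2) * pdy d L z * g z b a)) = _
    rw [hsymm b a, hsymm a d]
    ring
  · intro a b c
    -- `g^{uc} ∂L/∂y^u = 2 y^c`, by Euler's relation.
    have e3 : ∑ u, pdy u L z * (g z)⁻¹ u c = 2 * z.2 c := by
      have h : ∀ v, ∑ u, (g z)⁻¹ u c * g z u v = if v = c then 1 else 0 := by
        intro v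
        rw [← hinv c v]
        exact Finset.sum_congr rfl fun u _ => by rw [hinvsymm u c]
      calc ∑ u, pdy u L z * (g z)⁻¹ u c
          = 2 * ∑ v, z.2 v * ∑ u, (g z)⁻¹ u c * g z u v := by
            simp only [hEuler, Finset.mul_sum, Finset.sum_mul]
            rw [Finset.sum_comm]
            exact Finset.sum_congr rfl fun v _ => Finset.sum_congr rfl fun u _ => by ring
        _ = 2 * z.2 c := by simp [h]
    have e4 : ∑ u, z.2 u * (g z u b * (if a = c then 1 else 0)
        + g z a u * (if b = c then 1 else 0) - g z a b * (if u = c then 1 else 0)) =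
        (1 / 2) * pdy b L z * (if a = c then 1 else 0)
          + (1 / 2) * pdy a L z * (if b = c then 1 else 0) - g z a b * z.2 c := by
      have e5 : ∑ u, z.2 u * (g z a b * (if u = c then (1 : ℝ) else 0)) = g z a b * z.2 c := by
        simp [mul_comm]
      rw [hEuler, hEuler, ← e5]
      simp only [Finset.mul_sum, Finset.sum_mul]
      rw [← Finset.sum_add_distrib, ← Finset.sum_sub_distrib]
      refine Finset.sum_congr rfl fun u _ => ?_
      rw [hsymm b u]
      ring
    rw [e4]
    simp only [Fc, e3, horChristoffel]
    change (1 / 4) * (2 * ∑ d, _ + _ + _ - _) = (1 / 2) * ∑ d, (g z)⁻¹ c d *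
      (deltax L a (fun w => g w d b) z + deltax L b (fun w => g w a d) z
              - deltax L d (fun w => g w a b) z) + _
    ring
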